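/- **Setting.** In each round $t=1,2,\dots$ a context $x_t\in\mathcal X\subset\mathbb R^{d_0}$ is observed, a price $p_t\ge 0$ is posted, and $y_t=\mathbf 1\{v^*(x_t)+\epsilon_t\ge p_t\}$ is observed. The contexts are i.i.d.; the noise terms $\epsilon_t$ are i.i.d. with mean zero and distribution function $F$, independent of the contexts; $p_t$ depends only on information available before $\epsilon_t$ is realised (contexts up to round $t$, outcomes before round $t$, possibly independent randomisation), and $\epsilon_t$ is independent of this information. Put $\mathsf{Rev}_q(p)=p(1-F(p-q))$, let $p^*(x)$ maximise $\mathsf{Rev}_{v^*(x)}$ over $p\ge0$, and let $\mathrm{Reg}(T)=\sum_{t=1}^T\bigl[\mathsf{Rev}_{v^*(x_t)}(p^*(x_t))-\mathsf{Rev}_{v^*(x_t)}(p_t)\bigr]$. **Assumptions.** There are constants $B,B_\epsilon>0$, $L$, $C$, $\alpha>0$ and a function $\rho_{\mathcal V}\ge 0$ such that 1. (realizability) $v^*$ belongs to the known function class $\mathcal V$; 2. (bounded valuation) $|\epsilon_t|\le B_\epsilon$ almost surely and $v^*(x)\in[B_\epsilon,B-B_\epsilon]$ for all $x\in\mathcal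 X$; 3. (Lipschitz continuity) $|F(a)-F(b)|\le L|a-b|$ for all $a,b\in\mathbb R$; 4. (second-order smoothness) $\mathsf{Rev}_{v^*(x)}(p^*(x))-\mathsf{Rev}_{v^*(x)}(p)\le C(p^*(x)-p)^2$ for all $x\in\mathcal X$, $p\ge0$; 5. (online classification oracle) from the $n$ observations $(x_t,p_t,y_t)$ that the algorithm below collects in an episode of length $n$, the oracle returns, at confidence level $\delta$, a predictor $\hat v\in\mathcal V$ with $\|\hat v-v^*\|_\infty\le\sqrt{\rho_{\mathcal V}(\delta)/n^\alpha}$ with probability at least $1-\delta$. **Algorithm.** The price of round $1$ is an arbitrary element of $[0,B]$. Episode $k=1,2,\dots$ consists of the $T_k=2^{k-1}$ rounds $2^{k-1}+1,\dots,2^k$. Put $\hat v_1\equiv0$, and for $k\ge2$ let $\hat v_k$ be the output of the oracle at level $\delta$ on the data of episode $k-1$. Let $N_k=\lceil T_k^{1/5}\rceil$, let $S_k=\lceil\frac12\log_2T_k\rceil$ (and $S_1=1$), and let $m_1,\dots,m_{N_k}$ be the midpoints of the $N_k$ equal subintervals of $[-\|\hat v_k\|_\infty,B+\|\hat v_k\|_\infty]$.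 In a round $t$ of episode $k$ put $p_{t,j}=m_j+\hat v_k(x_t)$ and $\mathcal A_{t,1}=\{j:p_{t,j}\in(0,B)\}$. For a layer $s$ let $n_{t,s}^j$ be the number of earlier rounds of the episode that stopped in layer $s$ with index $j$, let $w_{t,s}^j$ be the mean of the outcomes $y$ in these rounds ($0$ if there are none), let $r_{t,s}^j=\min\{\sqrt{2\ln(2S_kN_kT_k/\delta)/n_{t,s}^j},1\}$ ($1$ if $n_{t,s}^j=0$), and let $\mathrm{UCB}_{t,s}^j=p_{t,j}(w_{t,s}^j+r_{t,s}^j)$. Starting from $s=1$: if $s=S_k$, choose $j_t\in\mathcal A_{t,s}$ maximising $\mathrm{UCB}_{t,s}^j$ and stop; otherwise, if $p_{t,j}r_{t,s}^j>B2^{-s}$ for some $j\in\mathcal A_{t,s}$, choose any such $j$ as $j_t$ and stop; otherwise put $\mathcal A_{t,s+1}=\{j\in\mathcal A_{t,s}:\mathrm{UCB}_{t,s}^j\ge\max_{j'\in\mathcal A_{t,s}}\mathrm{UCB}_{t,s}^{j'}-B2^{1-s}\}$ and continue with $s+1$. Post $p_t=p_{t,j_t}$ and record the round in the layer where it stopped.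 If $\mathcal A_{t,1}=\emptyset$, post an arbitrary price in $[0,B]$ and do not record the round. **Statement.** There is an absolute constant $c\in\mathbb N$, and for all $B,L,C,\alpha$ there is a constant $K>0$ depending only on $B,L,C,\alpha$, such that the following holds. Let $T\ge2$, let $0<\delta<1/(2\lceil\log_2T\rceil)$, let the assumptions hold, and suppose that $\alpha\le2$ or $\rho_{\mathcal V}(\delta)\le T^{3\alpha/5}$. Then the regret of the algorithm run at confidence level $\delta$ satisfies $$\mathrm{Reg}(T)\le K\,\ln^{c}(T/\delta)\,\max\bigl\{T^{3/5},\ \rho_{\mathcal V}(\delta)^{1/2}\,T^{1-\alpha/2}\bigr\}$$ with probability at least $1-2\lceil\log_2T\rceil\,\delta$. -/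

import Mathlib

open MeasureTheory ProbabilityTheory

noncomputable section

namespace DynPricing

/-- Sup norm of a function; the junk value `0` if the function is unbounded. -/
def supNorm {X : Type*} (v : X → ℝ) : ℝ := ⨆ x, |v x|

/-- Expected revenue `Rev_q(p) = p (1 - F(p - q))` for the noise law `ν` with cdf `F`. -/
def rev (ν : Measure ℝ) (q p : ℝ) : ℝ := p * (1 - cdf ν (p - q))

/-- `P` holds with probability at least `p`.  The event is allowed to be non-measurable,
in which case it has to contain a measurable event of probability at least `p`. -/
def WithProbAtLeast {Ω : Type*} [MeasurableSpace Ω] (μ : Measure Ω) (p : ℝ)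
    (P : Ω → Prop) : Prop :=
  ∃ E : Set Ω, MeasurableSet E ∧ p ≤ μ.real E ∧ ∀ ω ∈ E, P ω

/-! ### The environment -/

/-- Contexts i.i.d., noise i.i.d. with law `ν`, of mean zero, and independent of the contexts. -/
structure IsEnvironment {Ω X : Type*} [MeasurableSpace Ω] [MeasurableSpace X] (μ : Measure Ω)
    (x : ℕ → Ω → X) (ε : ℕ → Ω → ℝ) (ν : Measure ℝ) : Prop where
  measurable_context : ∀ t, Measurable (x t)
  measurable_noise : ∀ t, Measurable (ε t)
  indep_context : iIndepFun x μ
  ident_context : ∀ t, IdentDistrib (x t) (x 0) μ μ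
  indep_noise : iIndepFun ε μ
  law_noise : ∀ t, μ.map (ε t) = ν
  indep_context_noise : IndepFun (fun ω t => x t ω) (fun ω t => ε t ω) μ
  mean_zero : ∫ z, z ∂ν = 0

/-- Bounded valuation: `|ε_t| ≤ Bε` (almost surely) and `v* ∈ [Bε, B - Bε]`. -/
structure BoundedValuation {X : Type*} (ν : Measure ℝ) (vStar : X → ℝ) (Bε B : ℝ) : Prop where
  noise_pos : 0 < Bε
  noise_bound : ∀ᵐ z ∂ν, |z| ≤ Bε
  valuation_mem : ∀ x, vStar x ∈ Set.Icc Bε (B - Bε)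

/-- `pStar x` is an optimal price at the context `x`, that is, a maximiser of the expected
revenue over all prices `p ≥ 0`. -/
def IsOptimalPrice {X : Type*} (ν : Measure ℝ) (vStar pStar : X → ℝ) : Prop :=
  ∀ x, 0 ≤ pStar x ∧ ∀ p, 0 ≤ p → rev ν (vStar x) p ≤ rev ν (vStar x) (pStar x)

/-- Second-order smoothness of the revenue at the optimal prices. -/
def SecondOrderSmooth {X : Type*} (ν : Measure ℝ) (vStar pStar : X → ℝ) (C : ℝ) : Prop :=
  ∀ x, ∀ p, 0 ≤ p →
    rev ν (vStar x) (pStar x) - rev ν (vStar x) p ≤ C * (pStar x - p) ^ 2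

/-! ### Upper confidence bounds with layered data partitioning (UCB-LDP) -/

/-- One realisation of the pricing process: in round `t`, the context `x_t`, the posted price
`p_t`, the sale indicator `y_t`, the stopping layer `s_t` and the chosen index `j_t`. -/
structure Trajectory (X : Type*) where
  context : ℕ → X
  price : ℕ → ℝ
  sale : ℕ → ℝ
  layer : ℕ → ℕ
  arm : ℕ → ℕ

/-- The input of one call of UCB-LDP.  The call occupies the rounds
`start + 1, …, start + T`. -/
structure UCBInput (X : Type*) where
  est : X → ℝ
  N : ℕ
  T : ℕ
  B : ℝ
  δ : ℝ
  start : ℕ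

namespace UCBInput

variable {X : Type*} (I : UCBInput X) (h : Trajectory X)

/-- The number `S` of layers, `⌈(1/2) log₂ T⌉`, and one layer in the case `T = 1`. -/
def S : ℕ := max 1 ⌈Real.logb 2 (I.T : ℝ) / 2⌉₊

/-- `m_j`, `1 ≤ j ≤ N`: the midpoint of the `j`-th of the `N` intervals of equal length into which
`[-‖v̂‖_∞, B + ‖v̂‖_∞]` is divided. -/
def mid (j : ℕ) : ℝ :=
  -supNorm I.est + ((j : ℝ) - 1 / 2) * ((I.B + 2 * supNorm I.est) / (I.N : ℝ))

/-- The price `m_j + v̂(x_t)` of index `j` in round `t`. -/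
def armPrice (t j : ℕ) : ℝ := I.mid j + I.est (h.context t)

/-- `Ψ_t^s(j)`: the earlier rounds of this call that stopped in layer `s` with index `j`. -/
def stamps (t s j : ℕ) : Finset ℕ :=
  (Finset.Ioo I.start t).filter fun τ => h.layer τ = s ∧ h.arm τ = j

/-- The sample mean `w_{t,s}^j`, which is `0` if there is no sample. -/
def sampleMean (t s j : ℕ) : ℝ :=
  (∑ τ ∈ I.stamps h t s j, h.sale τ) / ((I.stamps h t s j).card : ℝ)

/-- The confidence radius `r_{t,s}^j`, which is `min {∞, 1} = 1` if there is no sample. -/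
def radius (t s j : ℕ) : ℝ :=
  if (I.stamps h t s j).card = 0 then 1
  else min (Real.sqrt (2 * Real.log (2 * (I.S : ℝ) * (I.N : ℝ) * (I.T : ℝ) / I.δ)
      / ((I.stamps h t s j).card : ℝ))) 1

/-- The upper confidence bound `UCB_{t,s}^j`. -/
def ucb (t s j : ℕ) : ℝ :=
  I.armPrice h t j * (I.sampleMean h t s j + I.radius h t s j)

open Classical in
/-- `𝒜_{t,1}`: the indices whose price lies in `(0, B)`. -/
def initialActions (t : ℕ) : Finset ℕ :=
  (Finset.Icc 1 I.N).filter fun j => I.armPrice h t j ∈ Set.Ioo 0 I.B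

open Classical in
/-- `𝒜_{t,s}` for `s ≥ 1` (the value at `s = 0` is not used).  The condition in the recursion says
that the upper confidence bound of `j` is at least `max_{j'} UCB_{t,s}^{j'} - B 2^{1-s}`. -/
def actions (t : ℕ) : ℕ → Finset ℕ
  | 0 => ∅
  | 1 => I.initialActions h t
  | s + 2 => (actions t (s + 1)).filter fun j =>
      ∀ j' ∈ actions t (s + 1),
        I.ucb h t (s + 1) j' - I.B * (2 : ℝ) ^ (1 - ((s + 1 : ℕ) : ℤ)) ≤ I.ucb h t (s + 1) j

/-- The index `j` passes the statistical precision check in layer `s`. -/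
def Precise (t s j : ℕ) : Prop :=
  I.armPrice h t j * I.radius h t s j ≤ I.B * (2 : ℝ) ^ (-(s : ℤ))

/-- Round `t` follows UCB-LDP with some price available: it stops in a layer `s` such that all
active indices passed the check in all earlier layers, and there it posts the price of an active
index that maximises the upper confidence bound, if `s` is the last layer, and of an active index
that fails the check, if `s` is not the last layer. -/
structure RegularRound (t : ℕ) : Prop where
  one_le_layer : 1 ≤ h.layer t
  layer_le : h.layer t ≤ I.S
  arm_mem : h.arm t ∈ I.actions h t (h.layer t)
  price_eq : h.price t = I.armPrice h t (h.arm t)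
  passed : ∀ s, 1 ≤ s → s < h.layer t → ∀ j ∈ I.actions h t s, I.Precise h t s j
  exploitation : h.layer t = I.S →
    ∀ j ∈ I.actions h t I.S, I.ucb h t I.S j ≤ I.ucb h t I.S (h.arm t)
  exploration : h.layer t < I.S → ¬ I.Precise h t (h.layer t) (h.arm t)

/-- Round `t` follows UCB-LDP.  If no price of the grid lies in `(0, B)`, then the price is an
arbitrary element of `[0, B]`, and the round is not recorded in any layer `s ≥ 1`. -/
def Round (t : ℕ) : Prop :=
  ((I.initialActions h t).Nonempty → I.RegularRound h t) ∧
  (¬ (I.initialActions h t).Nonempty → h.price t ∈ Set.Icc 0 I.B ∧ h.layer t = 0)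

end UCBInput

/-! ### The pricing algorithm with an online classification oracle -/

/-- An oracle maps a confidence level and a data set `(x_i, p_i, y_i)`, `i < n`, to a predictor. -/
abbrev Oracle (X : Type*) := ℝ → (n : ℕ) → (Fin n → X × ℝ × ℝ) → X → ℝ

/-- The length `T_k = 2^{k-1}` of the episode `k ≥ 1`, which consists of the rounds
`2^{k-1} + 1, …, 2^k`. -/
def epLength (k : ℕ) : ℕ := 2 ^ (k - 1)

/-- The data `(x_t, p_t, y_t)` of the episode `k ≥ 1`. -/
def epData {X : Type*} (h : Trajectory X) (k : ℕ) : Fin (epLength k) → X × ℝ × ℝ :=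
  fun i => (h.context (epLength k + 1 + i), h.price (epLength k + 1 + i),
    h.sale (epLength k + 1 + i))

/-- The estimator `v̂_k`: zero for `k = 1`, and the predictor returned by the oracle on the data of
the episode `k - 1` for `k ≥ 2`. -/
def estimator {X : Type*} (O : Oracle X) (δ : ℝ) (h : Trajectory X) (k : ℕ) : X → ℝ :=
  if k ≤ 1 then 0 else O δ (epLength (k - 1)) (epData h (k - 1))

/-- The call of UCB-LDP in the episode `k`, with `N_k = ⌈T_k^{1/5}⌉`. -/
def epInput {X : Type*} (O : Oracle X) (B δ : ℝ) (h : Trajectory X) (k : ℕ) : UCBInput X where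
  est := estimator O δ h k
  N := ⌈((epLength k : ℕ) : ℝ) ^ (1 / 5 : ℝ)⌉₊
  T := epLength k
  B := B
  δ := δ
  start := epLength k

/-- The trajectory `h` follows the algorithm.  Round `1` precedes the first episode; its
price is an arbitrary element of `[0, B]`. -/
def FollowsAlgorithm {X : Type*} (O : Oracle X) (B δ : ℝ) (h : Trajectory X) : Prop :=
  h.price 1 ∈ Set.Icc 0 B ∧
  ∀ k, 1 ≤ k → ∀ t ∈ Finset.Ioc (2 ^ (k - 1)) (2 ^ k), (epInput O B δ h k).Round h t

/-- `H` is a random run of the algorithm in the given environment.  The σ-algebra `G t` is the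
information available when the price of round `t` is posted: it contains the contexts up to round
`t` and the sales before round `t` (and possibly independent randomisation), and it is independent
of the noise in round `t`. -/
structure IsRun {Ω X : Type*} [MeasurableSpace X] {mΩ : MeasurableSpace Ω} (μ : Measure Ω)
    (x : ℕ → Ω → X) (ε : ℕ → Ω → ℝ) (vStar : X → ℝ) (O : Oracle X) (B δ : ℝ)
    (G : Filtration ℕ mΩ) (H : Ω → Trajectory X) : Prop where
  context_eq : ∀ ω t, (H ω).context t = x t ω
  sale_eq : ∀ ω t, (H ω).sale t = if (H ω).price t ≤ vStar (x t ω) + ε t ω then 1 else 0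
  follows : ∀ ω, FollowsAlgorithm O B δ (H ω)
  context_meas : ∀ t, Measurable[G t] (x t)
  price_meas : ∀ t, Measurable[G t] fun ω => (H ω).price t
  layer_meas : ∀ t, Measurable[G t] fun ω => (H ω).layer t
  arm_meas : ∀ t, Measurable[G t] fun ω => (H ω).arm t
  sale_meas : ∀ s t, s < t → Measurable[G t] fun ω => (H ω).sale s
  noise_indep : ∀ t, Indep (MeasurableSpace.comap (ε t) inferInstance) (G t) μ

/-- The oracle `O` returns, at confidence level `δ` and for the random data set `D` of size `n`, a
predictor with `‖v̂ - v*‖_∞ ≤ √(ρ(δ) / n^α)` with probability at least `1 - δ`. -/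
def OracleAccurate {Ω X : Type*} [MeasurableSpace Ω] (μ : Measure Ω) (vStar : X → ℝ)
    (O : Oracle X) (ρ : ℝ → ℝ) (α δ : ℝ) (n : ℕ) (D : Ω → Fin n → X × ℝ × ℝ) : Prop :=
  WithProbAtLeast μ (1 - δ) fun ω =>
    ∀ x, |O δ n (D ω) x - vStar x| ≤ Real.sqrt (ρ δ / (n : ℝ) ^ α)

/-- The cumulative regret over the rounds `1, …, T`. -/
def regret {X : Type*} (ν : Measure ℝ) (vStar pStar : X → ℝ) (h : Trajectory X) (T : ℕ) : ℝ :=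
  ∑ t ∈ Finset.Icc 1 T, (rev ν (vStar (h.context t)) (pStar (h.context t))
    - rev ν (vStar (h.context t)) (h.price t))

end DynPricing

end

/-! The price of index `j` is `m_j + v̂(x)`, so its sale probability is `1 - F(m_j + v̂(x) -
v*(x))`. By the Lipschitz condition this differs from `1 - F(m_j)`, which no longer involves the
context, by at most `L η`, where `η` bounds the error of `v̂`. Samples of one index taken at
different contexts can therefore be pooled, with bias `L η`, and an episode becomes a bandit problem
with `N` unknown probabilities and known, context-dependent factors.

Concentration. Layer and index of a round are known before its noise, so the selection of samples is
predictable. Hoeffding's lemma gives an exponential supermartingale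
(`IsFeedback.lintegral_exp_sum_le`). Markov's inequality and a union bound over rounds, layers,
indices and sample counts then make all confidence intervals of an episode valid with probability `1
- δ` (`IsRun.withProbAtLeast_noise`).

One episode. On this event, elimination in layer `s` keeps an index that is as good up to bias,
while every survivor is within `4 B 2^{-s}` of the best active one up to bias. So a round stopping
in layer `s` loses at most `8 B 2^{-s}` plus bias (`Good.proxy_le_chosen`). An exploring round of
layer `s` fails the precision check, so there are only about `N 4^s` of them up to logarithms, and
each layer costs about `√(N T_k)` (`Good.card_layer_mul_le`). Second-order smoothness bounds the
discretisation loss per round by the order of `N^{-2}` when `η ≤ 1`. With `N ≈ T_k^{1/5}` both costs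
are of order `T_k^{3/5}`, and the bias adds about `η T_k` (`Good.sum_regret_le_min`).

The whole run. The estimator of episode `k` comes from an episode of half the length, which
determines `η`; `min_le_rate` compares the resulting bias with the claimed rate. There are `⌈log₂
T⌉` episodes with two failure events each, whence the probability `1 - 2⌈log₂ T⌉δ`. Each episode
costs two logarithmic factors and the number of episodes a third. -/

namespace DynPricing

/-! ### Events of high probability -/

section HighProbability

variable {Ω : Type*} [MeasurableSpace Ω] {μ : Measure Ω}

theorem WithProbAtLeast.mono {p q : ℝ} {P Q : Ω → Prop} (h : WithProbAtLeast μ p P) (hq : q ≤ p)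
    (hPQ : ∀ ω, P ω → Q ω) : WithProbAtLeast μ q Q := by
  obtain ⟨E, hE, hp, hP⟩ := h
  exact ⟨E, hE, hq.trans hp, fun ω hω => hPQ ω (hP ω hω)⟩

variable [IsProbabilityMeasure μ]

theorem WithProbAtLeast.and {a b : ℝ} {P Q : Ω → Prop} (hP : WithProbAtLeast μ (1 - a) P)
    (hQ : WithProbAtLeast μ (1 - b) Q) :
    WithProbAtLeast μ (1 - (a + b)) fun ω => P ω ∧ Q ω := by
  obtain ⟨E, hE, hp, hP⟩ := hP
  obtain ⟨E', hE', hq, hQ⟩ := hQ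
  refine ⟨E ∩ E', hE.inter hE', ?_, fun ω hω => ⟨hP ω hω.1, hQ ω hω.2⟩⟩
  have h := measureReal_union_add_inter (μ := μ) (s := E) hE'
  have h1 : μ.real (E ∪ E') ≤ 1 := measureReal_le_one
  linarith

theorem WithProbAtLeast.forall_finset {ι : Type*} (s : Finset ι) {a : ι → ℝ} {P : ι → Ω → Prop}
    (h : ∀ i ∈ s, WithProbAtLeast μ (1 - a i) (P i)) :
    WithProbAtLeast μ (1 - ∑ i ∈ s, a i) fun ω => ∀ i ∈ s, P i ω := by
  classical
  induction s using Finset.induction_on with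
  | empty => exact ⟨Set.univ, MeasurableSet.univ, by simp, by simp⟩
  | insert i s hi ih =>
    rw [Finset.sum_insert hi]
    refine ((h i (by simp)).and (ih fun j hj => h j (by simp [hj]))).mono le_rfl ?_
    intro ω hω j hj
    rcases Finset.mem_insert.1 hj with rfl | hj
    exacts [hω.1, hω.2 j hj]

theorem withProbAtLeast_of_measureReal_le {a : ℝ} {E : Set Ω} (hE : MeasurableSet E)
    (h : μ.real E ≤ a) : WithProbAtLeast μ (1 - a) fun ω => ω ∉ E := by
  refine ⟨Eᶜ, hE.compl, ?_, fun ω hω => hω⟩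
  rw [measureReal_compl hE, probReal_univ]
  linarith

end HighProbability

/-! ### Bernoulli feedback -/

section Feedback

variable {ν : Measure ℝ}

section

variable [IsProbabilityMeasure ν]

/-- A sale occurs on a closed half-line of noise values, while `1 - F` measures the open one;
continuity of `F` excludes the atom that would separate them. -/
theorem measureReal_Ici_eq_one_sub_cdf (hν : Continuous (cdf ν)) (θ : ℝ) :
    ν.real (Set.Ici θ) = 1 - cdf ν θ := by
  have : NullSingletonClass ν := ⟨fun a => by
    rw [← measure_cdf ν, StieltjesFunction.measure_singleton,
      (hν.continuousAt.continuousWithinAt).leftLim_eq]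
    simp⟩
  rw [cdf_eq_real, ← measureReal_congr (Ioi_ae_eq_Ici (μ := ν) (a := θ)), ← Set.compl_Iic,
    measureReal_compl measurableSet_Iic, probReal_univ]

/-- Hoeffding's lemma for the indicator of `θ ≤ z`. -/
theorem lintegral_exp_indicator_le (hν : Continuous (cdf ν)) (θ b : ℝ) :
    ∫⁻ z, ENNReal.ofReal (Real.exp (b * ((if θ ≤ z then 1 else 0) - (1 - cdf ν θ)))) ∂ν
      ≤ ENNReal.ofReal (Real.exp (b ^ 2 / 8)) := by
  have hm : Measurable fun z : ℝ => if θ ≤ z then (1 : ℝ) else 0 :=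
    Measurable.ite measurableSet_Ici measurable_const measurable_const
  have hmean : ∫ z, (if θ ≤ z then (1 : ℝ) else 0) ∂ν = 1 - cdf ν θ := by
    rw [← measureReal_Ici_eq_one_sub_cdf hν, ← integral_indicator_one measurableSet_Ici]
    congr 1
  have hs := hasSubgaussianMGF_of_mem_Icc (μ := ν) (a := 0) (b := 1) hm.aemeasurable
    (Filter.Eventually.of_forall fun z => by
      show (if θ ≤ z then (1 : ℝ) else 0) ∈ Set.Icc 0 1
      split_ifs <;> simp)
  rw [hmean] at hs
  rw [← ofReal_integral_eq_lintegral_ofReal (hs.integrable_exp_mul b)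
    (Filter.Eventually.of_forall fun z => (Real.exp_pos _).le)]
  refine ENNReal.ofReal_le_ofReal ((hs.mgf_le b).trans (le_of_eq ?_))
  congr 1
  norm_num
  ring

/-- One step of the supermartingale. Independence makes the joint law of the past data and the new
noise a product, so the noise can be integrated out first with weight and threshold frozen. Working
with `∫⁻` avoids any integrability condition on `w`. -/
theorem lintegral_exp_add_le {Ω : Type*} {m mΩ : MeasurableSpace Ω} {μ : Measure Ω}
    [IsProbabilityMeasure μ] (hm : m ≤ mΩ) (hν : Continuous (cdf ν))
    {ε w b θ : Ω → ℝ} (hε : Measurable ε) (hlaw : μ.map ε = ν)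
    (hind : Indep (MeasurableSpace.comap ε inferInstance) m μ)
    (hw : Measurable[m] w) (hb : Measurable[m] b) (hθ : Measurable[m] θ) :
    ∫⁻ ω, ENNReal.ofReal (Real.exp (w ω
      + (b ω * ((if θ ω ≤ ε ω then 1 else 0) - (1 - cdf ν (θ ω))) - b ω ^ 2 / 8))) ∂μ
      ≤ ∫⁻ ω, ENNReal.ofReal (Real.exp (w ω)) ∂μ := by
  set U : Ω → ℝ × ℝ × ℝ := fun ω => (w ω, b ω, θ ω)
  have hUm : Measurable[m] U := hw.prodMk (hb.prodMk hθ)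
  have hUm' : Measurable U := hUm.mono hm le_rfl
  have hindF : IndepFun U ε μ := by
    rw [IndepFun_iff_Indep]
    exact indep_of_indep_of_le_left hind.symm hUm.comap_le
  have hmap := (indepFun_iff_map_prod_eq_prod_map_map hUm'.aemeasurable hε.aemeasurable).1 hindF
  rw [hlaw] at hmap
  set f : (ℝ × ℝ × ℝ) × ℝ → ENNReal := fun p => ENNReal.ofReal (Real.exp (p.1.1
    + (p.1.2.1 * ((if p.1.2.2 ≤ p.2 then 1 else 0) - (1 - cdf ν p.1.2.2)) - p.1.2.1 ^ 2 / 8)))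
    with hf
  have hcdf : Measurable (cdf ν) := (monotone_cdf ν).measurable
  have hfm : Measurable f := by
    have h1 : Measurable fun p : (ℝ × ℝ × ℝ) × ℝ => if p.1.2.2 ≤ p.2 then (1 : ℝ) else 0 :=
      Measurable.ite (measurableSet_le (by fun_prop) (by fun_prop)) measurable_const
        measurable_const
    have h2 : Measurable fun p : (ℝ × ℝ × ℝ) × ℝ => cdf ν p.1.2.2 := hcdf.comp (by fun_prop)
    simp only [hf]
    fun_prop
  calc _ = ∫⁻ ω, f (U ω, ε ω) ∂μ := rfl
    _ = ∫⁻ p, f p ∂(μ.map fun ω => (U ω, ε ω)) := (lintegral_map hfm (hUm'.prodMk hε)).symm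
    _ = ∫⁻ u, ∫⁻ z, f (u, z) ∂ν ∂(μ.map U) := by rw [hmap, lintegral_prod _ hfm.aemeasurable]
    _ ≤ ∫⁻ u, ENNReal.ofReal (Real.exp u.1) ∂(μ.map U) := by
      refine lintegral_mono fun u => ?_
      have h1 : ∀ z, f (u, z) = ENNReal.ofReal (Real.exp (u.1 - u.2.1 ^ 2 / 8)) *
          ENNReal.ofReal (Real.exp (u.2.1 * ((if u.2.2 ≤ z then 1 else 0)
            - (1 - cdf ν u.2.2)))) := by
        intro z
        rw [← ENNReal.ofReal_mul (Real.exp_pos _).le, ← Real.exp_add]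
        simp only [hf]
        congr 2
        ring
      simp_rw [h1]
      rw [lintegral_const_mul' _ _ ENNReal.ofReal_ne_top]
      refine (mul_le_mul_right (lintegral_exp_indicator_le hν u.2.2 u.2.1) _).trans ?_
      rw [← ENNReal.ofReal_mul (Real.exp_pos _).le, ← Real.exp_add]
      simp
    _ = ∫⁻ ω, ENNReal.ofReal (Real.exp (w ω)) ∂μ := by
      rw [lintegral_map (by fun_prop) hUm']

end

variable {Ω : Type*} {mΩ : MeasurableSpace Ω} {μ : Measure Ω}

/-- Bernoulli feedback `y_t = 1{θ_t ≤ ε_t}` with predictable thresholds `θ_t`. -/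
structure IsFeedback (μ : Measure Ω) (ν : Measure ℝ) (G : Filtration ℕ mΩ) (ε θ y : ℕ → Ω → ℝ) :
    Prop where
  measurable_noise : ∀ t, Measurable (ε t)
  law_noise : ∀ t, μ.map (ε t) = ν
  noise_indep : ∀ t, Indep (MeasurableSpace.comap (ε t) inferInstance) (G t) μ
  threshold_meas : ∀ t, Measurable[G t] (θ t)
  meas : ∀ s t, s < t → Measurable[G t] (y s)
  eq_ite : ∀ t ω, y t ω = if θ t ω ≤ ε t ω then 1 else 0

variable {G : Filtration ℕ mΩ} {ε θ y : ℕ → Ω → ℝ}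

theorem IsFeedback.measurable (hf : IsFeedback μ ν G ε θ y) (t : ℕ) : Measurable (y t) :=
  (hf.meas t (t + 1) t.lt_succ_self).mono (G.le _) le_rfl

/-- The deviation of the feedback from its conditional mean, over the rounds `τ < t` with
`a_τ = 1`. -/
noncomputable def deviation (ν : Measure ℝ) (θ y a : ℕ → Ω → ℝ) (t : ℕ) (ω : Ω) : ℝ :=
  ∑ τ ∈ Finset.range t, a τ ω * (y τ ω - (1 - cdf ν (θ τ ω)))

theorem IsFeedback.measurable_deviation (hf : IsFeedback μ ν G ε θ y)
    {a : ℕ → Ω → ℝ} (ha : ∀ t, Measurable[G t] (a t)) (t : ℕ) :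
    Measurable (deviation ν θ y a t) := by
  have hcdf : Measurable (cdf ν) := (monotone_cdf ν).measurable
  refine Finset.measurable_sum _ fun τ _ => ?_
  have h1 : Measurable (a τ) := (ha τ).mono (G.le _) le_rfl
  have h2 : Measurable (θ τ) := (hf.threshold_meas τ).mono (G.le _) le_rfl
  have h3 : Measurable fun ω => cdf ν (θ τ ω) := hcdf.comp h2
  have h4 := hf.measurable τ
  fun_prop

variable [IsProbabilityMeasure ν] [IsProbabilityMeasure μ]

/-- The weights may depend on the past, which covers samples chosen adaptively by the algorithm; no
independence among the selected samples is needed. -/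
theorem IsFeedback.lintegral_exp_sum_le (hf : IsFeedback μ ν G ε θ y) (hν : Continuous (cdf ν))
    {b : ℕ → Ω → ℝ} (hb : ∀ t, Measurable[G t] (b t)) (t : ℕ) :
    ∫⁻ ω, ENNReal.ofReal (Real.exp (∑ τ ∈ Finset.range t,
      (b τ ω * (y τ ω - (1 - cdf ν (θ τ ω))) - b τ ω ^ 2 / 8))) ∂μ ≤ 1 := by
  have hcdf : Measurable (cdf ν) := (monotone_cdf ν).measurable
  induction t with
  | zero => simp
  | succ t ih =>
    refine le_trans ?_ ih
    simp_rw [Finset.sum_range_succ, hf.eq_ite t]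
    refine lintegral_exp_add_le (G.le t) hν (hf.measurable_noise t) (hf.law_noise t)
      (hf.noise_indep t) ?_ (hb t) (hf.threshold_meas t)
    refine Finset.measurable_sum _ fun τ hτ => ?_
    have hτ := Finset.mem_range.1 hτ
    have h1 : Measurable[G t] (b τ) := (hb τ).mono (G.mono hτ.le) le_rfl
    have h2 : Measurable[G t] (θ τ) := (hf.threshold_meas τ).mono (G.mono hτ.le) le_rfl
    have h3 : Measurable[G t] fun ω => cdf ν (θ τ ω) := hcdf.comp h2
    have h4 := hf.meas τ t hτ
    fun_prop

/-- Markov's inequality for the exponential supermartingale. Fixing the sample count to a number `n`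
allows a deterministic tilt, although the count itself is random. -/
theorem IsFeedback.measureReal_deviation_le (hf : IsFeedback μ ν G ε θ y)
    (hν : Continuous (cdf ν)) {a : ℕ → Ω → ℝ} (ha : ∀ t, Measurable[G t] (a t))
    (ha01 : ∀ t ω, a t ω = 0 ∨ a t ω = 1) (t : ℕ) {n : ℝ} (hn : 0 < n) (l : ℝ) (hl : 0 ≤ l) :
    μ.real {ω | ∑ τ ∈ Finset.range t, a τ ω = n ∧
      Real.sqrt (2 * n * l) ≤ |deviation ν θ y a t ω|} ≤ 2 * Real.exp (-(4 * l)) := by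
  set r := Real.sqrt (2 * n * l) with hr
  have hr2 : r ^ 2 = 2 * n * l := Real.sq_sqrt (by positivity)
  have key : ∀ σ : ℝ, σ ^ 2 = 1 → μ.real {ω | ∑ τ ∈ Finset.range t, a τ ω = n ∧
      r ≤ σ * deviation ν θ y a t ω} ≤ Real.exp (-(4 * l)) := by
    intro σ hσ
    -- The tilt `4 r / n` maximises `c r - c² n / 8` over `c`, with maximum `2 r² / n = 4 l`; `σ =
    -- ±1` selects the tail.
    have h0 := hf.lintegral_exp_sum_le hν (b := fun t ω => σ * (4 * r / n) * a t ω)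
      (fun t => (ha t).const_mul _) t
    have hmeas : Measurable fun ω => ENNReal.ofReal (Real.exp (∑ τ ∈ Finset.range t,
        (σ * (4 * r / n) * a τ ω * (y τ ω - (1 - cdf ν (θ τ ω)))
          - (σ * (4 * r / n) * a τ ω) ^ 2 / 8))) := by
      have hcdf : Measurable (cdf ν) := (monotone_cdf ν).measurable
      refine (Real.measurable_exp.comp ?_).ennreal_ofReal
      refine Finset.measurable_sum _ fun τ _ => ?_
      have h1 : Measurable (a τ) := (ha τ).mono (G.le _) le_rfl
      have h2 : Measurable (θ τ) := (hf.threshold_meas τ).mono (G.le _) le_rfl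
      have h3 : Measurable fun ω => cdf ν (θ τ ω) := hcdf.comp h2
      have h4 := hf.measurable τ
      fun_prop
    have h1 := (mul_meas_ge_le_lintegral₀ hmeas.aemeasurable
      (ENNReal.ofReal (Real.exp (4 * l)))).trans h0
    have hsub : {ω | ∑ τ ∈ Finset.range t, a τ ω = n ∧ r ≤ σ * deviation ν θ y a t ω} ⊆
        {ω | ENNReal.ofReal (Real.exp (4 * l)) ≤ ENNReal.ofReal (Real.exp
          (∑ τ ∈ Finset.range t, (σ * (4 * r / n) * a τ ω * (y τ ω - (1 - cdf ν (θ τ ω)))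
          - (σ * (4 * r / n) * a τ ω) ^ 2 / 8)))} := by
      rintro ω ⟨hcount, hdev⟩
      refine ENNReal.ofReal_le_ofReal (Real.exp_le_exp.2 ?_)
      have e : ∑ τ ∈ Finset.range t, (σ * (4 * r / n) * a τ ω * (y τ ω - (1 - cdf ν (θ τ ω)))
          - (σ * (4 * r / n) * a τ ω) ^ 2 / 8)
          = (4 * r / n) * (σ * deviation ν θ y a t ω) - (4 * r / n) ^ 2 / 8 * n := by
        rw [Finset.sum_sub_distrib, ← hcount, deviation, Finset.mul_sum, Finset.mul_sum,
          Finset.mul_sum]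
        congr 1
        · exact Finset.sum_congr rfl fun τ _ => by ring
        · refine Finset.sum_congr rfl fun τ _ => ?_
          have : a τ ω ^ 2 = a τ ω := by rcases ha01 τ ω with h | h <;> simp [h]
          rw [mul_pow, mul_pow, hσ, this]
          ring
      have h2 : (4 * r / n) * r ≤ (4 * r / n) * (σ * deviation ν θ y a t ω) :=
        mul_le_mul_of_nonneg_left hdev (by positivity)
      have h3 : (4 * r / n) * r - (4 * r / n) ^ 2 / 8 * n = 4 * l := by
        have : (4 * r / n) * r - (4 * r / n) ^ 2 / 8 * n = 2 * r ^ 2 / n := by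
          field_simp
          ring
        rw [this, hr2]
        field_simp
        ring
      linarith
    have h2 : ENNReal.ofReal (Real.exp (4 * l)) *
        μ {ω | ∑ τ ∈ Finset.range t, a τ ω = n ∧ r ≤ σ * deviation ν θ y a t ω} ≤ 1 :=
      (mul_le_mul_right (measure_mono hsub) _).trans h1
    have h3 := ENNReal.toReal_mono ENNReal.one_ne_top h2
    rw [ENNReal.toReal_mul, ENNReal.toReal_ofReal (Real.exp_pos _).le, ENNReal.toReal_one] at h3
    rw [Real.exp_neg, ← one_div, le_div_iff₀ (Real.exp_pos _), mul_comm]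
    exact h3
  have hsub : {ω | ∑ τ ∈ Finset.range t, a τ ω = n ∧ r ≤ |deviation ν θ y a t ω|} ⊆
      {ω | ∑ τ ∈ Finset.range t, a τ ω = n ∧ r ≤ 1 * deviation ν θ y a t ω} ∪
      {ω | ∑ τ ∈ Finset.range t, a τ ω = n ∧ r ≤ (-1) * deviation ν θ y a t ω} := by
    rintro ω ⟨h1, h2⟩
    rcases le_abs.1 h2 with h | h
    · exact Or.inl ⟨h1, by simpa using h⟩
    · exact Or.inr ⟨h1, by simpa using h⟩
  calc _ ≤ _ := measureReal_mono hsub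
    _ ≤ _ := measureReal_union_le _ _
    _ ≤ Real.exp (-(4 * l)) + Real.exp (-(4 * l)) :=
      add_le_add (key 1 (by norm_num)) (key (-1) (by norm_num))
    _ = _ := by ring

/-- A union bound over a finite family of predictable selections with at most `m` rounds each. -/
theorem IsFeedback.withProbAtLeast_deviation (hf : IsFeedback μ ν G ε θ y)
    (hν : Continuous (cdf ν)) {ι : Type*} (s : Finset ι) (a : ι → ℕ → Ω → ℝ)
    (ha : ∀ i t, Measurable[G t] (a i t)) (ha01 : ∀ i t ω, a i t ω = 0 ∨ a i t ω = 1)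
    (u : ι → ℕ) (m : ℕ) (l : ℝ) (hl : 0 ≤ l) :
    WithProbAtLeast μ (1 - s.card * (m * (2 * Real.exp (-(4 * l))))) fun ω =>
      ∀ i ∈ s, ∀ n : ℕ, 1 ≤ n → n ≤ m → ∑ τ ∈ Finset.range (u i), a i τ ω = n →
        |deviation ν θ y (a i) (u i) ω| ≤ Real.sqrt (2 * n * l) := by
  -- The random sample count is handled by including all its possible values in the union bound.
  have h := WithProbAtLeast.forall_finset (μ := μ) (s ×ˢ Finset.Icc 1 m)
    (a := fun _ => 2 * Real.exp (-(4 * l)))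
    (P := fun p ω => ω ∉ {ω | ∑ τ ∈ Finset.range (u p.1), a p.1 τ ω = (p.2 : ℝ) ∧
      Real.sqrt (2 * (p.2 : ℝ) * l) ≤ |deviation ν θ y (a p.1) (u p.1) ω|}) ?_
  · refine h.mono (le_of_eq ?_) ?_
    · simp only [Finset.sum_const, Finset.card_product, Nat.card_Icc, nsmul_eq_mul]
      push_cast
      simp
      ring
    · intro ω hω i hi n hn hnm hcount
      have := hω (i, n) (by simp [hi, hn, hnm])
      by_contra hcon
      exact this ⟨hcount, (not_le.1 hcon).le⟩
  · rintro ⟨i, n⟩ hin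
    have hn : 1 ≤ n := by
      simp only [Finset.mem_product, Finset.mem_Icc] at hin
      exact hin.2.1
    refine withProbAtLeast_of_measureReal_le ?_ (hf.measureReal_deviation_le hν (ha i) (ha01 i)
      (u i) (by exact_mod_cast hn) l hl)
    have h1 : Measurable fun ω => ∑ τ ∈ Finset.range (u i), a i τ ω :=
      Finset.measurable_sum _ fun τ _ => (ha i τ).mono (G.le _) le_rfl
    have h2 := hf.measurable_deviation (ha i) (u i)
    exact (measurableSet_eq_fun h1 measurable_const).inter
      (measurableSet_le measurable_const h2.abs)

end Feedback

/-! ### Revenue -/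

section Revenue

variable {X : Type*} {ν : Measure ℝ} {vStar pStar : X → ℝ} {Bε B L C : ℝ}

theorem rev_le_price {q p : ℝ} (hp : 0 ≤ p) : rev ν q p ≤ p := by
  have h := cdf_nonneg ν (p - q)
  unfold rev
  nlinarith

theorem rev_nonneg {q p : ℝ} (hp : 0 ≤ p) : 0 ≤ rev ν q p :=
  mul_nonneg hp (sub_nonneg.2 (cdf_le_one ν _))

theorem cdf_eq_one_of_bound [IsProbabilityMeasure ν] (h : ∀ᵐ z ∂ν, |z| ≤ Bε) {z : ℝ}
    (hz : Bε ≤ z) : cdf ν z = 1 := by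
  rw [cdf_eq_real]
  have : ν (Set.Iic z) = 1 := by
    rw [← prob_compl_eq_zero_iff measurableSet_Iic]
    refine measure_mono_null ?_ (ae_iff.1 h)
    intro y hy
    simp only [Set.mem_compl_iff, Set.mem_Iic, not_le] at hy
    exact not_le.2 ((hz.trans_lt hy).trans_le (le_abs_self y))
  rw [measureReal_def, this, ENNReal.toReal_one]

/-- A price greater than `B` generates no revenue. -/
theorem BoundedValuation.rev_eq_zero [IsProbabilityMeasure ν]
    (hb : BoundedValuation ν vStar Bε B) (x : X) {p : ℝ} (hp : B < p) :
    rev ν (vStar x) p = 0 := by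
  have h := (hb.valuation_mem x).2
  rw [rev, cdf_eq_one_of_bound hb.noise_bound (by linarith)]
  simp

theorem BoundedValuation.pos (hb : BoundedValuation ν vStar Bε B) (x : X) : 0 < B := by
  have h := hb.valuation_mem x
  have := hb.noise_pos
  linarith [h.1, h.2]

theorem BoundedValuation.rev_optimal_le [IsProbabilityMeasure ν]
    (hb : BoundedValuation ν vStar Bε B) (ho : IsOptimalPrice ν vStar pStar) (x : X) :
    rev ν (vStar x) (pStar x) ≤ B := by
  rcases le_or_gt (pStar x) B with h | h
  · exact (rev_le_price (ho x).1).trans h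
  · rw [hb.rev_eq_zero x h]
    exact (hb.pos x).le

end Revenue

namespace UCBInput

variable {X : Type*} {I : UCBInput X} {h : Trajectory X}

/-! ### The sets of active indices -/

theorem actions_succ {t s : ℕ} (hs : 1 ≤ s) {j : ℕ} : j ∈ I.actions h t (s + 1) ↔
    j ∈ I.actions h t s ∧ ∀ j' ∈ I.actions h t s,
      I.ucb h t s j' - I.B * (2 : ℝ) ^ (1 - (s : ℤ)) ≤ I.ucb h t s j := by
  obtain ⟨s, rfl⟩ := Nat.exists_eq_succ_of_ne_zero (by omega : s ≠ 0)
  simp [actions]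

theorem actions_subset_initialActions (t s : ℕ) : I.actions h t s ⊆ I.initialActions h t := by
  induction s with
  | zero => simp [actions]
  | succ s ih =>
    rcases Nat.eq_zero_or_pos s with rfl | hs
    · simp [actions]
    · exact fun j hj => ih ((actions_succ hs).1 hj).1

theorem mem_initialActions {t j : ℕ} : j ∈ I.initialActions h t ↔
    (1 ≤ j ∧ j ≤ I.N) ∧ 0 < I.armPrice h t j ∧ I.armPrice h t j < I.B := by
  simp [initialActions]

theorem radius_nonneg (t s j : ℕ) : 0 ≤ I.radius h t s j := by
  unfold radius
  split_ifs
  · exact zero_le_one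
  · exact le_min (Real.sqrt_nonneg _) zero_le_one

/-! ### One call of UCB-LDP -/

/-- The logarithmic factor `ln (2 S N T / δ)` in the confidence radius. -/
noncomputable def logTerm (I : UCBInput X) : ℝ :=
  Real.log (2 * (I.S : ℝ) * (I.N : ℝ) * (I.T : ℝ) / I.δ)

/-- The rounds of the call. -/
def rounds (I : UCBInput X) : Finset ℕ := Finset.Ioc I.start (I.start + I.T)

/-- The sum of the sales minus their conditional means, over the rounds that stopped in layer `s`
with index `j`. -/
noncomputable def noiseSum (ν : Measure ℝ) (vStar : X → ℝ) (I : UCBInput X) (h : Trajectory X)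
    (t s j : ℕ) : ℝ :=
  ∑ τ ∈ I.stamps h t s j, (h.sale τ - (1 - cdf ν (h.price τ - vStar (h.context τ))))

/-- A call of UCB-LDP in which the estimator and all confidence intervals are accurate. -/
structure Good (ν : Measure ℝ) (vStar : X → ℝ) (L η : ℝ) (I : UCBInput X) (h : Trajectory X) :
    Prop where
  B_pos : 0 < I.B
  N_pos : 1 ≤ I.N
  lip_nonneg : 0 ≤ L
  err_nonneg : 0 ≤ η
  lipschitz : ∀ a b : ℝ, |cdf ν a - cdf ν b| ≤ L * |a - b|
  accurate : ∀ x, |I.est x - vStar x| ≤ η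
  round : ∀ t ∈ I.rounds, I.Round h t
  sale_mem : ∀ t, h.sale t ∈ Set.Icc 0 1
  noise : ∀ t ∈ I.rounds, ∀ s ∈ Finset.Icc 1 I.S, ∀ j ∈ Finset.Icc 1 I.N,
    |noiseSum ν vStar I h t s j| ≤ Real.sqrt (2 * (I.stamps h t s j).card * I.logTerm)

/-- The revenue of index `j` in round `t` for a correct estimator. -/
noncomputable def proxy (ν : Measure ℝ) (I : UCBInput X) (h : Trajectory X) (t j : ℕ) : ℝ :=
  I.armPrice h t j * (1 - cdf ν (I.mid j))

namespace Good

variable {ν : Measure ℝ} {vStar : X → ℝ} {L η : ℝ}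

theorem regularRound_of_layer (hg : Good ν vStar L η I h) {t : ℕ} (ht : t ∈ I.rounds)
    (hl : 1 ≤ h.layer t) : I.RegularRound h t := by
  by_cases hne : (I.initialActions h t).Nonempty
  · exact (hg.round t ht).1 hne
  · have := ((hg.round t ht).2 hne).2
    omega

/-- The truncation of the radius at `1` is harmless because every summand of the noise has absolute
value at most `1`. -/
theorem noise_le_radius (hg : Good ν vStar L η I h) {t s j : ℕ} (ht : t ∈ I.rounds)
    (hs : s ∈ Finset.Icc 1 I.S) (hj : j ∈ Finset.Icc 1 I.N) :
    |noiseSum ν vStar I h t s j| ≤ (I.stamps h t s j).card * I.radius h t s j := by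
  rcases Nat.eq_zero_or_pos (I.stamps h t s j).card with h0 | h0
  · rw [Finset.card_eq_zero] at h0
    simp [noiseSum, h0]
  have hn : (0 : ℝ) < (I.stamps h t s j).card := by exact_mod_cast h0
  rw [radius, if_neg h0.ne', mul_min_of_nonneg _ _ hn.le]
  refine le_min ((hg.noise t ht s hs j hj).trans (le_of_eq ?_)) ?_
  · set n : ℝ := ((I.stamps h t s j).card : ℝ)
    change _ = n * Real.sqrt (2 * I.logTerm / n)
    have : 2 * n * I.logTerm = n ^ 2 * (2 * I.logTerm / n) := by field_simp
    rw [this, Real.sqrt_mul (sq_nonneg n), Real.sqrt_sq hn.le]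
  · refine (Finset.abs_sum_le_sum_abs _ _).trans ?_
    refine (Finset.sum_le_card_nsmul _ _ 1 fun τ _ => ?_).trans (le_of_eq (by simp))
    have h1 := hg.sale_mem τ
    have h2 := cdf_nonneg ν (h.price τ - vStar (h.context τ))
    have h3 := cdf_le_one ν (h.price τ - vStar (h.context τ))
    rw [abs_le]
    constructor <;> linarith [h1.1, h1.2]

theorem cdf_armPrice (hg : Good ν vStar L η I h) (t j : ℕ) :
    |cdf ν (I.armPrice h t j - vStar (h.context t)) - cdf ν (I.mid j)| ≤ L * η := by
  refine (hg.lipschitz _ _).trans (mul_le_mul_of_nonneg_left ?_ hg.lip_nonneg)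
  have : I.armPrice h t j - vStar (h.context t) - I.mid j
      = I.est (h.context t) - vStar (h.context t) := by
    unfold armPrice
    ring
  rw [this]
  exact hg.accurate _

/-- The error splits into noise, controlled by the radius, and the bias from pooling different
contexts, at most `L η` per sample. Without samples the radius `1` makes the bound trivial. -/
theorem sampleMean_sub_le (hg : Good ν vStar L η I h) {t s j : ℕ} (ht : t ∈ I.rounds)
    (hs : s ∈ Finset.Icc 1 I.S) (hj : j ∈ Finset.Icc 1 I.N) :
    |I.sampleMean h t s j - (1 - cdf ν (I.mid j))| ≤ I.radius h t s j + L * η := by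
  have hLη : 0 ≤ L * η := mul_nonneg hg.lip_nonneg hg.err_nonneg
  rcases Nat.eq_zero_or_pos (I.stamps h t s j).card with h0 | h0
  · have h2 := cdf_nonneg ν (I.mid j)
    have h3 := cdf_le_one ν (I.mid j)
    rw [sampleMean, radius, if_pos h0, h0, Nat.cast_zero, div_zero, abs_le]
    constructor <;> linarith
  have hn : (0 : ℝ) < (I.stamps h t s j).card := by exact_mod_cast h0
  set n : ℝ := ((I.stamps h t s j).card : ℝ) with hn_def
  have hbias : |∑ τ ∈ I.stamps h t s j,
      (cdf ν (I.mid j) - cdf ν (h.price τ - vStar (h.context τ)))| ≤ n * (L * η) := by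
    refine (Finset.abs_sum_le_sum_abs _ _).trans ?_
    refine (Finset.sum_le_card_nsmul _ _ (L * η) fun τ hτ => ?_).trans (le_of_eq (by simp [hn_def]))
    simp only [stamps, Finset.mem_filter, Finset.mem_Ioo] at hτ
    simp only [rounds, Finset.mem_Ioc] at ht
    have hreg : I.RegularRound h τ := by
      refine hg.regularRound_of_layer ?_ ?_
      · simp only [rounds, Finset.mem_Ioc]
        omega
      · rw [hτ.2.1]
        exact (Finset.mem_Icc.1 hs).1
    rw [hreg.price_eq, hτ.2.2, abs_sub_comm]
    exact hg.cdf_armPrice τ j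
  have hsum : n * (I.sampleMean h t s j - (1 - cdf ν (I.mid j))) = noiseSum ν vStar I h t s j
      + ∑ τ ∈ I.stamps h t s j,
        (cdf ν (I.mid j) - cdf ν (h.price τ - vStar (h.context τ))) := by
    rw [noiseSum, ← Finset.sum_add_distrib, sampleMean, mul_sub, mul_div_cancel₀ _ hn.ne']
    have : n * (1 - cdf ν (I.mid j)) = ∑ _τ ∈ I.stamps h t s j, (1 - cdf ν (I.mid j)) := by
      rw [Finset.sum_const, nsmul_eq_mul]
    rw [this, ← Finset.sum_sub_distrib]
    exact Finset.sum_congr rfl fun τ _ => by ring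
  have hle : n * |I.sampleMean h t s j - (1 - cdf ν (I.mid j))|
      ≤ n * (I.radius h t s j + L * η) := by
    calc _ = |n * (I.sampleMean h t s j - (1 - cdf ν (I.mid j)))| := by
          rw [abs_mul, abs_of_pos hn]
      _ ≤ n * I.radius h t s j + n * (L * η) := by
          rw [hsum]
          exact (abs_add_le _ _).trans (add_le_add (hg.noise_le_radius ht hs hj) hbias)
      _ = _ := by ring
  exact le_of_mul_le_mul_left hle hn

theorem ucb_bounds (hg : Good ν vStar L η I h) {t s j : ℕ} (ht : t ∈ I.rounds)
    (hs : s ∈ Finset.Icc 1 I.S) (hj : j ∈ I.initialActions h t) :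
    proxy ν I h t j - I.B * (L * η) ≤ I.ucb h t s j ∧
      I.ucb h t s j ≤ proxy ν I h t j + 2 * (I.armPrice h t j * I.radius h t s j)
        + I.B * (L * η) := by
  obtain ⟨hj1, hp0, hpB⟩ := mem_initialActions.1 hj
  have hLη : 0 ≤ L * η := mul_nonneg hg.lip_nonneg hg.err_nonneg
  obtain ⟨h1, h2⟩ := abs_le.1 (hg.sampleMean_sub_le ht hs (Finset.mem_Icc.2 hj1))
  have h3 : I.armPrice h t j * (L * η) ≤ I.B * (L * η) := mul_le_mul_of_nonneg_right hpB.le hLη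
  have h4 := mul_le_mul_of_nonneg_left h1 hp0.le
  have h5 := mul_le_mul_of_nonneg_left h2 hp0.le
  rw [ucb, proxy]
  constructor <;> linarith

theorem two_zpow_one_sub (s : ℕ) : (2 : ℝ) ^ (1 - (s : ℤ)) = 2 * 2 ^ (-(s : ℤ)) := by
  rw [sub_eq_add_neg, zpow_add₀ two_ne_zero, zpow_one]

/-- If all active indices pass the check, then some index survives that is nearly as good as any
given active one. -/
theorem exists_survivor (hg : Good ν vStar L η I h) {t s : ℕ} (ht : t ∈ I.rounds)
    (hs : s ∈ Finset.Icc 1 I.S) (hp : ∀ j ∈ I.actions h t s, I.Precise h t s j) {j : ℕ}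
    (hj : j ∈ I.actions h t s) :
    ∃ j' ∈ I.actions h t (s + 1), proxy ν I h t j ≤ proxy ν I h t j' + 2 * (I.B * (L * η)) := by
  have hs1 := (Finset.mem_Icc.1 hs).1
  have hLη : 0 ≤ I.B * (L * η) :=
    mul_nonneg hg.B_pos.le (mul_nonneg hg.lip_nonneg hg.err_nonneg)
  have hpow : 0 ≤ I.B * (2 : ℝ) ^ (1 - (s : ℤ)) := mul_nonneg hg.B_pos.le (by positivity)
  obtain ⟨m, hm, hmax⟩ := Finset.exists_max_image _ (I.ucb h t s) ⟨j, hj⟩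
  have hmem : m ∈ I.actions h t (s + 1) :=
    (actions_succ hs1).2 ⟨hm, fun j' hj' => by linarith [hmax j' hj']⟩
  by_cases hk : j ∈ I.actions h t (s + 1)
  · exact ⟨j, hk, by linarith⟩
  -- A discarded `j` lies more than `2 B 2^{-s}` below the maximiser `m`. This covers the whole
  -- interval width of `m`, which passed the check, so only the bias remains as a loss.
  · refine ⟨m, hmem, ?_⟩
    have hlt : I.ucb h t s j < I.ucb h t s m - I.B * (2 : ℝ) ^ (1 - (s : ℤ)) := by
      by_contra hcon
      exact hk ((actions_succ hs1).2 ⟨hj, fun j' hj' => by linarith [hmax j' hj']⟩)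
    have h1 := (hg.ucb_bounds ht hs (actions_subset_initialActions t s hj)).1
    have h2 := (hg.ucb_bounds ht hs (actions_subset_initialActions t s hm)).2
    have h3 := hp m hm
    unfold Precise at h3
    rw [two_zpow_one_sub] at hlt
    linarith

/-- Two terms `B 2^{-s}` come from the slack of the elimination rule and two from the width of the
confidence interval of `j'`. -/
theorem survivor_le (hg : Good ν vStar L η I h) {t s : ℕ} (ht : t ∈ I.rounds)
    (hs : s ∈ Finset.Icc 1 I.S) (hp : ∀ j ∈ I.actions h t s, I.Precise h t s j) {j j' : ℕ}
    (hj : j ∈ I.actions h t s) (hj' : j' ∈ I.actions h t (s + 1)) :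
    proxy ν I h t j ≤ proxy ν I h t j' + 4 * (I.B * 2 ^ (-(s : ℤ))) + 2 * (I.B * (L * η)) := by
  have hs1 := (Finset.mem_Icc.1 hs).1
  obtain ⟨hm, hmax⟩ := (actions_succ hs1).1 hj'
  have h0 := hmax j hj
  have h1 := (hg.ucb_bounds ht hs (actions_subset_initialActions t s hj)).1
  have h2 := (hg.ucb_bounds ht hs (actions_subset_initialActions t s hm)).2
  have h3 := hp j' hm
  unfold Precise at h3
  rw [two_zpow_one_sub] at h0
  linarith

/-- Iterating `exists_survivor` accumulates bias only, and no term of size `2^{-s}`. -/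
theorem exists_active (hg : Good ν vStar L η I h) {t s : ℕ} (ht : t ∈ I.rounds) (hs : 1 ≤ s)
    (hsS : s ≤ I.S) (hp : ∀ s', 1 ≤ s' → s' < s → ∀ j ∈ I.actions h t s', I.Precise h t s' j)
    {j : ℕ} (hj : j ∈ I.initialActions h t) :
    ∃ j' ∈ I.actions h t s,
      proxy ν I h t j ≤ proxy ν I h t j' + 2 * ((s : ℝ) - 1) * (I.B * (L * η)) := by
  induction s, hs using Nat.le_induction with
  | base => exact ⟨j, by simpa [actions] using hj, by simp⟩
  | succ s hs ih =>
    obtain ⟨i, hi, hle⟩ := ih (by omega) fun s' h1 h2 => hp s' h1 (by omega)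
    obtain ⟨j', hj', hle'⟩ := hg.exists_survivor ht (Finset.mem_Icc.2 ⟨hs, by omega⟩)
      (hp s hs (by omega)) hi
    refine ⟨j', hj', ?_⟩
    push_cast
    linarith

theorem proxy_bounds {t j : ℕ} (hj : j ∈ I.initialActions h t) :
    0 ≤ proxy ν I h t j ∧ proxy ν I h t j ≤ I.B := by
  obtain ⟨-, hp0, hpB⟩ := mem_initialActions.1 hj
  have h2 := cdf_nonneg ν (I.mid j)
  have h3 := cdf_le_one ν (I.mid j)
  unfold proxy
  constructor <;> nlinarith

/-- The chosen index is nearly as good as any other one. -/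
theorem proxy_le_chosen (hg : Good ν vStar L η I h) {t : ℕ} (ht : t ∈ I.rounds)
    (hr : I.RegularRound h t) {j : ℕ} (hj : j ∈ I.initialActions h t) :
    proxy ν I h t j ≤ proxy ν I h t (h.arm t) + 8 * (I.B * 2 ^ (-(h.layer t : ℤ)))
      + 2 * (I.S : ℝ) * (I.B * (L * η)) := by
  have hLη : 0 ≤ I.B * (L * η) :=
    mul_nonneg hg.B_pos.le (mul_nonneg hg.lip_nonneg hg.err_nonneg)
  have harm := hr.arm_mem
  have hS := hr.layer_le
  have h1 := hr.one_le_layer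
  have hp := hr.passed
  have hin := actions_subset_initialActions _ _ harm
  -- In layer `1` nothing has been eliminated yet, but there `8 B 2^{-1} = 4 B` exceeds the trivial
  -- bound `B`.
  rcases h1.eq_or_lt with he | hlt
  · have h2 := (proxy_bounds (ν := ν) hj).2
    have h3 := (proxy_bounds (ν := ν) hin).1
    have h4 : 0 ≤ 2 * (I.S : ℝ) * (I.B * (L * η)) := by positivity
    rw [← he]
    norm_num
    linarith [hg.B_pos]
  · obtain ⟨s, hs⟩ := Nat.exists_eq_add_of_lt hlt
    have hs' : h.layer t = (s + 1) + 1 := by omega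
    rw [hs'] at harm hS hp ⊢
    -- The chosen index survived the preceding layer `s + 1`, so it is compared there with a good
    -- active index `i`. The loss `4 B 2^{-(s+1)}` is `8 B 2^{-(s+2)}`, and the bias terms add up to
    -- `2 s + 2 ≤ 2 S`.
    obtain ⟨i, hi, hle⟩ := hg.exists_active ht (by omega : 1 ≤ s + 1) (by omega)
      (fun s' h1 h2 => hp s' h1 (by omega)) hj
    have h5 := hg.survivor_le ht (Finset.mem_Icc.2 ⟨by omega, by omega⟩)
      (hp (s + 1) (by omega) (by omega)) hi harm
    have h6 : (2 : ℝ) ^ (-((s + 1 : ℕ) : ℤ)) = 2 * 2 ^ (-((s + 1 + 1 : ℕ) : ℤ)) := by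
      rw [← two_zpow_one_sub]
      congr 1
    rw [h6] at h5
    have h7 : ((s + 1 : ℕ) : ℝ) ≤ I.S := by exact_mod_cast (by omega : s + 1 ≤ I.S)
    have h8 := mul_le_mul_of_nonneg_right h7 hLη
    linarith

theorem rev_sub_proxy_le (hg : Good ν vStar L η I h) {t j : ℕ} (hj : j ∈ I.initialActions h t) :
    |rev ν (vStar (h.context t)) (I.armPrice h t j) - proxy ν I h t j| ≤ I.B * (L * η) := by
  obtain ⟨-, hp0, hpB⟩ := mem_initialActions.1 hj
  have h1 : rev ν (vStar (h.context t)) (I.armPrice h t j) - proxy ν I h t j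
      = -(I.armPrice h t j *
        (cdf ν (I.armPrice h t j - vStar (h.context t)) - cdf ν (I.mid j))) := by
    unfold rev proxy
    ring
  rw [h1, abs_neg, abs_mul, abs_of_pos hp0]
  exact mul_le_mul hpB.le (hg.cdf_armPrice t j) (abs_nonneg _) hg.B_pos.le

theorem rev_le_rev_price (hg : Good ν vStar L η I h) {t : ℕ} (ht : t ∈ I.rounds)
    (hr : I.RegularRound h t) {j : ℕ} (hj : j ∈ I.initialActions h t) :
    rev ν (vStar (h.context t)) (I.armPrice h t j) ≤ rev ν (vStar (h.context t)) (h.price t)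
      + 8 * (I.B * 2 ^ (-(h.layer t : ℤ))) + 2 * ((I.S : ℝ) + 1) * (I.B * (L * η)) := by
  have h1 := (abs_le.1 (hg.rev_sub_proxy_le hj)).2
  have h2 := (abs_le.1 (hg.rev_sub_proxy_le (actions_subset_initialActions _ _ hr.arm_mem))).1
  have h3 := hg.proxy_le_chosen ht hr hj
  rw [hr.price_eq]
  linarith

/-! ### Counting the rounds of a layer -/

/-- Consider the last such round: all the others are its samples. It failed the check at a price
below `B`, so its radius exceeds `2^{-s}`, which limits the sample count to `2 logTerm · 4^s`; the
round itself is the extra one. -/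
theorem card_layer_arm_le (hg : Good ν vStar L η I h) (hl : 0 ≤ I.logTerm) {s : ℕ} (hs : 1 ≤ s)
    (hsS : s < I.S) (j : ℕ) :
    ((I.rounds.filter fun t => h.layer t = s ∧ h.arm t = j).card : ℝ)
      ≤ (2 * I.logTerm + 1) * 4 ^ s := by
  set F := I.rounds.filter fun t => h.layer t = s ∧ h.arm t = j with hF
  rcases F.eq_empty_or_nonempty with he | hne
  · rw [he]
    simp only [Finset.card_empty, Nat.cast_zero]
    positivity
  set t := F.max' hne with ht
  have htF : t ∈ F := F.max'_mem hne
  obtain ⟨htr, hlay, harm⟩ := Finset.mem_filter.1 htF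
  have hsub : F.erase t ⊆ I.stamps h t s j := by
    intro τ hτ
    obtain ⟨hne', hτF⟩ := Finset.mem_erase.1 hτ
    obtain ⟨h1, h2⟩ := Finset.mem_filter.1 hτF
    have h3 := F.le_max' τ hτF
    simp only [rounds, Finset.mem_Ioc] at h1
    exact Finset.mem_filter.2 ⟨Finset.mem_Ioo.2 ⟨h1.1, lt_of_le_of_ne h3 hne'⟩, h2⟩
  have hcard : F.card ≤ (I.stamps h t s j).card + 1 := by
    have := Finset.card_le_card hsub
    rw [Finset.card_erase_of_mem htF] at this
    omega
  have hreg := hg.regularRound_of_layer htr (by omega)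
  have hex := hreg.exploration (by omega)
  rw [hlay, harm] at hex
  have hin := actions_subset_initialActions _ _ hreg.arm_mem
  rw [harm] at hin
  obtain ⟨-, hp0, hpB⟩ := mem_initialActions.1 hin
  have hrad : (2 : ℝ) ^ (-(s : ℤ)) < I.radius h t s j := by
    unfold Precise at hex
    rw [not_le] at hex
    by_contra hcon
    have h1 := mul_le_mul hpB.le (not_lt.1 hcon) (radius_nonneg t s j) hg.B_pos.le
    linarith
  have h4 : (1 : ℝ) ≤ 4 ^ s := one_le_pow₀ (by norm_num)
  have hn : ((I.stamps h t s j).card : ℝ) ≤ 2 * I.logTerm * 4 ^ s := by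
    rcases Nat.eq_zero_or_pos (I.stamps h t s j).card with h0 | h0
    · rw [h0, Nat.cast_zero]
      positivity
    have hnpos : (0 : ℝ) < (I.stamps h t s j).card := by exact_mod_cast h0
    rw [radius, if_neg h0.ne'] at hrad
    have h5 := hrad.trans_le (min_le_left _ _)
    have h6 := (Real.lt_sqrt (by positivity)).1 h5
    change _ < 2 * I.logTerm / _ at h6
    rw [lt_div_iff₀ hnpos] at h6
    have h7 : ((2 : ℝ) ^ (-(s : ℤ))) ^ 2 = (4 ^ s)⁻¹ := by
      rw [zpow_neg, zpow_natCast, inv_pow, ← pow_mul, mul_comm, pow_mul]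
      norm_num
    rw [h7] at h6
    calc ((I.stamps h t s j).card : ℝ)
        = ((4 ^ s)⁻¹ * ((I.stamps h t s j).card : ℝ)) * 4 ^ s := by field_simp
      _ ≤ _ := mul_le_mul_of_nonneg_right h6.le (by positivity)
  have h8 : (F.card : ℝ) ≤ (I.stamps h t s j).card + 1 := by exact_mod_cast hcard
  linarith

theorem arm_mem_Icc (hg : Good ν vStar L η I h) {t : ℕ} (ht : t ∈ I.rounds)
    (hl : 1 ≤ h.layer t) : h.arm t ∈ Finset.Icc 1 I.N :=
  Finset.mem_Icc.2 (mem_initialActions.1 (actions_subset_initialActions _ _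
    (hg.regularRound_of_layer ht hl).arm_mem)).1

theorem card_layer_le (hg : Good ν vStar L η I h) (hl : 0 ≤ I.logTerm) {s : ℕ} (hs : 1 ≤ s)
    (hsS : s < I.S) :
    ((I.rounds.filter fun t => h.layer t = s).card : ℝ)
      ≤ I.N * ((2 * I.logTerm + 1) * 4 ^ s) := by
  have h1 := Finset.card_eq_sum_card_fiberwise (s := I.rounds.filter fun t => h.layer t = s)
    (t := Finset.Icc 1 I.N) (f := h.arm) (by
      intro t ht
      obtain ⟨ht1, ht2⟩ := Finset.mem_filter.1 (Finset.mem_coe.1 ht)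
      exact hg.arm_mem_Icc ht1 (by omega))
  rw [h1]
  push_cast
  refine (Finset.sum_le_card_nsmul _ _ _ fun j _ => ?_).trans (le_of_eq (by
    rw [Nat.card_Icc, nsmul_eq_mul, Nat.add_sub_cancel]))
  rw [Finset.filter_filter]
  exact hg.card_layer_arm_le hl hs hsS j

/-- The count is at most `T` and at most `N (2 logTerm + 1) 4^s`; multiplying the two bounds cancels
the factor `4^{-s}`. The last layer has no precision check, but there the second bound follows from
`T ≤ 4^S`, which is why `S` is half the binary logarithm of `T`. -/
theorem card_layer_mul_le (hg : Good ν vStar L η I h) (hT : 1 ≤ I.T) (hl : 0 ≤ I.logTerm) {s : ℕ}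
    (hs : 1 ≤ s) (hsS : s ≤ I.S) :
    ((I.rounds.filter fun t => h.layer t = s).card : ℝ) * 2 ^ (-(s : ℤ))
      ≤ Real.sqrt (I.T * I.N * (2 * I.logTerm + 1)) := by
  set n : ℝ := ((I.rounds.filter fun t => h.layer t = s).card : ℝ) with hn
  have hnT : n ≤ I.T := by
    have := Finset.card_filter_le I.rounds fun t => h.layer t = s
    rw [hn]
    exact_mod_cast this.trans_eq (by simp [rounds])
  have hT0 : (0 : ℝ) ≤ I.T := Nat.cast_nonneg _
  have hTpos : (0 : ℝ) < I.T := by exact_mod_cast hT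
  have hn0 : 0 ≤ n := Nat.cast_nonneg _
  have hN : (1 : ℝ) ≤ I.N := by exact_mod_cast hg.N_pos
  refine Real.le_sqrt_of_sq_le ?_
  have h7 : ((2 : ℝ) ^ (-(s : ℤ))) ^ 2 = (4 ^ s)⁻¹ := by
    rw [zpow_neg, zpow_natCast, inv_pow, ← pow_mul, mul_comm, pow_mul]
    norm_num
  have h4 : (0 : ℝ) < 4 ^ s := by positivity
  rw [mul_pow, h7, ← div_eq_mul_inv, div_le_iff₀ h4]
  have hkey : n ≤ I.N * ((2 * I.logTerm + 1) * 4 ^ s) := by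
    rcases hsS.lt_or_eq with hlt | rfl
    · exact hg.card_layer_le hl hs hlt
    · refine hnT.trans ?_
      have h5 : (I.T : ℝ) ≤ 4 ^ I.S := by
        have h6 : Real.logb 2 (I.T : ℝ) / 2 ≤ (I.S : ℝ) :=
          (Nat.le_ceil _).trans (by exact_mod_cast le_max_right _ _)
        have h7 : Real.logb 2 (I.T : ℝ) ≤ ((2 * I.S : ℕ) : ℝ) := by
          push_cast
          linarith
        rw [Real.logb_le_iff_le_rpow (by norm_num) hTpos, Real.rpow_natCast, pow_mul] at h7
        norm_num at h7
        exact h7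
      have h8 : (1 : ℝ) * (1 * 4 ^ I.S) ≤ I.N * ((2 * I.logTerm + 1) * 4 ^ I.S) := by
        gcongr
        linarith
      linarith
  calc n ^ 2 = n * n := sq n
    _ ≤ I.T * (I.N * ((2 * I.logTerm + 1) * 4 ^ s)) := mul_le_mul hnT hkey hn0 hT0
    _ = _ := by ring

theorem sum_layer_le (hg : Good ν vStar L η I h) (hT : 1 ≤ I.T) (hl : 0 ≤ I.logTerm) :
    ∑ t ∈ I.rounds.filter (fun t => 1 ≤ h.layer t), (2 : ℝ) ^ (-(h.layer t : ℤ))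
      ≤ I.S * Real.sqrt (I.T * I.N * (2 * I.logTerm + 1)) := by
  have hmaps : ∀ t ∈ I.rounds.filter (fun t => 1 ≤ h.layer t),
      h.layer t ∈ Finset.Icc 1 I.S := by
    intro t ht
    obtain ⟨ht1, ht2⟩ := Finset.mem_filter.1 ht
    exact Finset.mem_Icc.2 ⟨ht2, (hg.regularRound_of_layer ht1 ht2).layer_le⟩
  rw [← Finset.sum_fiberwise_of_maps_to hmaps]
  refine (Finset.sum_le_card_nsmul _ _ _ fun s hs => ?_).trans (le_of_eq (by
    rw [Nat.card_Icc, nsmul_eq_mul, Nat.add_sub_cancel]))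
  have hs' := Finset.mem_Icc.1 hs
  refine le_trans (le_of_eq ?_) (hg.card_layer_mul_le hT hl hs'.1 hs'.2)
  rw [Finset.filter_filter, Finset.filter_congr (q := fun t => h.layer t = s)
    (fun t _ => ⟨And.right, fun he => ⟨hs'.1.trans_eq he.symm, he⟩⟩),
    Finset.sum_congr rfl (g := fun _ => (2 : ℝ) ^ (-(s : ℤ)))
      fun t ht => by rw [(Finset.mem_filter.1 ht).2], Finset.sum_const, nsmul_eq_mul]

end Good

end UCBInput

/-! ### Approximation by the price grid and the regret of one call -/

theorem abs_le_supNorm {X : Type*} {v : X → ℝ} {a : ℝ} (h : ∀ x, |v x| ≤ a) (x : X) :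
    |v x| ≤ supNorm v :=
  le_ciSup (f := fun x => |v x|) ⟨a, by rintro _ ⟨y, rfl⟩; exact h y⟩ x

theorem supNorm_le {X : Type*} [Nonempty X] {v : X → ℝ} {a : ℝ} (h : ∀ x, |v x| ≤ a) :
    supNorm v ≤ a :=
  ciSup_le h

theorem supNorm_nonneg {X : Type*} (v : X → ℝ) : 0 ≤ supNorm v :=
  Real.iSup_nonneg fun _ => abs_nonneg _

/-- The midpoints of `N` intervals of length `d`, starting at `a`, approximate all points of
`[a, a + N d]` up to `d / 2`. -/
theorem exists_midpoint_near {a d z : ℝ} {N : ℕ} (hN : 1 ≤ N) (hd : 0 < d) (h0 : a ≤ z)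
    (h1 : z ≤ a + N * d) :
    ∃ j : ℕ, 1 ≤ j ∧ j ≤ N ∧ |a + ((j : ℝ) - 1 / 2) * d - z| ≤ d / 2 := by
  have hu0 : 0 ≤ (z - a) / d := div_nonneg (by linarith) hd.le
  have huz : (z - a) / d * d = z - a := div_mul_cancel₀ _ hd.ne'
  set u := (z - a) / d with hu
  have hab : ∀ j : ℕ, u ≤ j → (j : ℝ) - 1 ≤ u → |a + ((j : ℝ) - 1 / 2) * d - z| ≤ d / 2 := by
    intro j h2 h3
    have h4 := mul_le_mul_of_nonneg_right h2 hd.le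
    have h5 := mul_le_mul_of_nonneg_right h3 hd.le
    rw [abs_le]
    constructor <;> linarith
  have huN : u ≤ N := by
    rw [hu, div_le_iff₀ hd]
    linarith
  rcases hu0.eq_or_lt with he | hpos
  · exact ⟨1, le_rfl, hN, hab 1 (by rw [← he]; simp) (by rw [← he]; simp)⟩
  · refine ⟨⌈u⌉₊, Nat.one_le_ceil_iff.2 hpos, Nat.ceil_le.2 huN, hab _ (Nat.le_ceil u) ?_⟩
    linarith [Nat.ceil_lt_add_one hpos.le]

namespace UCBInput

variable {X : Type*} {I : UCBInput X} {h : Trajectory X}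

/-- The distance of neighbouring prices of the grid. -/
noncomputable def gridStep (I : UCBInput X) : ℝ := (I.B + 2 * supNorm I.est) / (I.N : ℝ)

namespace Good

variable {ν : Measure ℝ} {vStar pStar : X → ℝ} {L η Bε C : ℝ}

theorem abs_est_le (hg : Good ν vStar L η I h) (hb : BoundedValuation ν vStar Bε I.B) (x : X) :
    |I.est x| ≤ I.B + η := by
  have h1 := abs_le.1 (hg.accurate x)
  have h2 := hb.valuation_mem x
  have h3 := hb.noise_pos
  rw [abs_le]
  constructor <;> linarith [h1.1, h1.2, h2.1, h2.2]

theorem gridStep_pos (hg : Good ν vStar L η I h) : 0 < I.gridStep := by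
  have := supNorm_nonneg I.est
  have h1 := hg.B_pos
  have h2 : (0 : ℝ) < I.N := by exact_mod_cast hg.N_pos
  unfold gridStep
  positivity

/-- Some active price is close to any given price in `[0, B]`. -/
theorem exists_initialActions_near (hg : Good ν vStar L η I h)
    (hb : BoundedValuation ν vStar Bε I.B) (hd : I.gridStep < I.B / 2) (t : ℕ) {p : ℝ}
    (hp0 : 0 ≤ p) (hpB : p ≤ I.B) :
    ∃ j ∈ I.initialActions h t, |I.armPrice h t j - p| ≤ 3 / 2 * I.gridStep := by
  have hdpos := hg.gridStep_pos
  have hN : (0 : ℝ) < I.N := by exact_mod_cast hg.N_pos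
  obtain ⟨hv0, hv1⟩ := abs_le.1 (abs_le_supNorm (hg.abs_est_le hb) (h.context t))
  set d := I.gridStep with hddef
  have hNd : (I.N : ℝ) * d = I.B + 2 * supNorm I.est := by
    rw [hddef, gridStep]
    field_simp
  -- The target is first moved into `[d, B - d]`, at cost at most `d`, so that a grid price within
  -- `d / 2` of it lies strictly inside `(0, B)`.
  obtain ⟨q, hq0, hq1, hqp⟩ : ∃ q, d ≤ q ∧ q ≤ I.B - d ∧ |q - p| ≤ d := by
    refine ⟨max d (min p (I.B - d)), le_max_left _ _,
      max_le (by linarith) (min_le_right _ _), ?_⟩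
    rw [abs_le]
    rcases max_cases d (min p (I.B - d)) with h1 | h1 <;>
      rcases min_cases p (I.B - d) with h2 | h2 <;> constructor <;> linarith [h1.1, h1.2, h2.1, h2.2]
  obtain ⟨j, hj1, hjN, hj⟩ := exists_midpoint_near (a := -supNorm I.est) (d := d)
    (z := q - I.est (h.context t)) hg.N_pos hdpos (by linarith) (by linarith)
  have harm : I.armPrice h t j = -supNorm I.est + ((j : ℝ) - 1 / 2) * d
      + I.est (h.context t) := rfl
  obtain ⟨h3, h4⟩ := abs_le.1 hj
  obtain ⟨h5, h6⟩ := abs_le.1 hqp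
  refine ⟨j, mem_initialActions.2 ⟨⟨hj1, hjN⟩, by linarith, by linarith⟩, ?_⟩
  rw [abs_le]
  constructor <;> linarith

theorem price_mem (hg : Good ν vStar L η I h) {t : ℕ} (ht : t ∈ I.rounds) :
    0 ≤ h.price t ∧ h.price t ≤ I.B := by
  by_cases hne : (I.initialActions h t).Nonempty
  · have hr := (hg.round t ht).1 hne
    obtain ⟨-, h1, h2⟩ := mem_initialActions.1 (actions_subset_initialActions _ _ hr.arm_mem)
    rw [hr.price_eq]
    exact ⟨h1.le, h2.le⟩
  · exact ((hg.round t ht).2 hne).1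

variable [IsProbabilityMeasure ν]

theorem regret_round_le (hg : Good ν vStar L η I h)
    (hb : BoundedValuation ν vStar Bε I.B) (ho : IsOptimalPrice ν vStar pStar)
    (hC : SecondOrderSmooth ν vStar pStar C) {t : ℕ} (ht : t ∈ I.rounds) :
    rev ν (vStar (h.context t)) (pStar (h.context t)) - rev ν (vStar (h.context t)) (h.price t)
      ≤ (9 / 4 * |C| + 4 / I.B) * I.gridStep ^ 2
        + 8 * I.B * (if 1 ≤ h.layer t then 2 ^ (-(h.layer t : ℤ)) else 0)
        + 2 * ((I.S : ℝ) + 1) * (I.B * (L * η)) := by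
  set x := h.context t
  have hB := hg.B_pos
  have hLη : 0 ≤ I.B * (L * η) :=
    mul_nonneg hg.B_pos.le (mul_nonneg hg.lip_nonneg hg.err_nonneg)
  have h2 : 0 ≤ 2 * ((I.S : ℝ) + 1) * (I.B * (L * η)) := by positivity
  have h3 : (0 : ℝ) ≤ 8 * I.B * (if 1 ≤ h.layer t then 2 ^ (-(h.layer t : ℤ)) else 0) := by
    split_ifs <;> positivity
  have h4 : 0 ≤ 9 / 4 * |C| * I.gridStep ^ 2 := by positivity
  have h5 : 0 ≤ 4 / I.B * I.gridStep ^ 2 := by positivity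
  have hprice := hg.price_mem ht
  have hrev0 := rev_nonneg (ν := ν) (q := vStar x) hprice.1
  -- A coarse grid, possibly without any admissible price, is covered by the trivial bound `B`; the
  -- coefficient `4 / B` is chosen for this case.
  rcases le_or_gt (I.B / 2) I.gridStep with hd | hd
  · have h6 : I.B ≤ 4 / I.B * I.gridStep ^ 2 := by
      have : (I.B / 2) ^ 2 ≤ I.gridStep ^ 2 := pow_le_pow_left₀ (by positivity) hd 2
      calc I.B = 4 / I.B * (I.B / 2) ^ 2 := by field_simp; norm_num
        _ ≤ _ := mul_le_mul_of_nonneg_left this (by positivity)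
    have h7 := hb.rev_optimal_le ho x
    linarith
  -- An optimal price above `B` earns nothing, so the regret is then nonpositive.
  rcases le_or_gt (pStar x) I.B with hp | hp
  · obtain ⟨j, hj, hclose⟩ := hg.exists_initialActions_near hb hd t (ho x).1 hp
    have hr := (hg.round t ht).1 ⟨j, hj⟩
    have h6 := hg.rev_le_rev_price ht hr hj
    have h7 := hC x (I.armPrice h t j) (mem_initialActions.1 hj).2.1.le
    have h8 : C * (pStar x - I.armPrice h t j) ^ 2 ≤ |C| * (3 / 2 * I.gridStep) ^ 2 := by
      refine mul_le_mul (le_abs_self C) ?_ (sq_nonneg _) (abs_nonneg C)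
      rw [← sq_abs, abs_sub_comm]
      exact pow_le_pow_left₀ (abs_nonneg _) hclose 2
    rw [if_pos hr.one_le_layer]
    linarith
  · rw [hb.rev_eq_zero x hp]
    linarith

theorem sum_regret_le (hg : Good ν vStar L η I h)
    (hb : BoundedValuation ν vStar Bε I.B) (ho : IsOptimalPrice ν vStar pStar)
    (hC : SecondOrderSmooth ν vStar pStar C) (hT : 1 ≤ I.T) (hl : 0 ≤ I.logTerm) :
    ∑ t ∈ I.rounds, (rev ν (vStar (h.context t)) (pStar (h.context t))
        - rev ν (vStar (h.context t)) (h.price t))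
      ≤ (9 / 4 * |C| + 4 / I.B) * (I.T * I.gridStep ^ 2)
        + 8 * I.B * (I.S * Real.sqrt (I.T * I.N * (2 * I.logTerm + 1)))
        + 2 * ((I.S : ℝ) + 1) * (I.B * (L * η)) * I.T := by
  refine (Finset.sum_le_sum fun t ht => hg.regret_round_le hb ho hC ht).trans ?_
  rw [Finset.sum_add_distrib, Finset.sum_add_distrib, ← Finset.mul_sum (a := 8 * I.B),
    ← Finset.sum_filter]
  have hcard : (I.rounds.card : ℝ) = I.T := by simp [rounds]
  have h1 := mul_le_mul_of_nonneg_left (hg.sum_layer_le hT hl)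
    (by linarith [hg.B_pos] : 0 ≤ 8 * I.B)
  simp only [Finset.sum_const, nsmul_eq_mul, hcard]
  linarith

theorem sum_regret_le_trivial (hg : Good ν vStar L η I h)
    (hb : BoundedValuation ν vStar Bε I.B) (ho : IsOptimalPrice ν vStar pStar) :
    ∑ t ∈ I.rounds, (rev ν (vStar (h.context t)) (pStar (h.context t))
        - rev ν (vStar (h.context t)) (h.price t)) ≤ I.B * I.T := by
  refine (Finset.sum_le_card_nsmul _ _ I.B fun t ht => ?_).trans (le_of_eq ?_)
  · have h1 := rev_nonneg (ν := ν) (q := vStar (h.context t)) (hg.price_mem ht).1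
    linarith [hb.rev_optimal_le ho (h.context t)]
  · simp [rounds, mul_comm]

end Good

end UCBInput

/-! ### The confidence intervals of an episode -/

section Noise

variable {Ω X : Type*} {mΩ : MeasurableSpace Ω} {μ : Measure Ω}
  {x : ℕ → Ω → X} {ε : ℕ → Ω → ℝ} {ν : Measure ℝ} {vStar : X → ℝ} {O : Oracle X} {B δ : ℝ}
  {G : Filtration ℕ mΩ} {H : Ω → Trajectory X}

open Classical in
/-- The indicator of the event that round `τ` is in the episode `k` and stops in layer `s` with
index `j`. -/
noncomputable def stampIndicator (H : Ω → Trajectory X) (k s j τ : ℕ) (ω : Ω) : ℝ :=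
  if epLength k < τ ∧ (H ω).layer τ = s ∧ (H ω).arm τ = j then 1 else 0

theorem sum_stampIndicator_mul (k s j t : ℕ) (ω : Ω) (f : ℕ → ℝ) :
    ∑ τ ∈ Finset.range t, stampIndicator H k s j τ ω * f τ
      = ∑ τ ∈ (epInput O B δ (H ω) k).stamps (H ω) t s j, f τ := by
  have h1 : (epInput O B δ (H ω) k).stamps (H ω) t s j = (Finset.range t).filter fun τ =>
      epLength k < τ ∧ (H ω).layer τ = s ∧ (H ω).arm τ = j := by
    ext τ
    simp only [UCBInput.stamps, epInput, Finset.mem_filter, Finset.mem_Ioo, Finset.mem_range]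
    tauto
  rw [h1, Finset.sum_filter]
  refine Finset.sum_congr rfl fun τ _ => ?_
  unfold stampIndicator
  split_ifs <;> simp

/-- With `Q = 2 S N T / δ` the left side is `δ T / Q³`, and `Q ≥ T`. -/
theorem exp_neg_log_bound {S N T δ : ℝ} (hS : 1 ≤ S) (hN : 1 ≤ N) (hT : 1 ≤ T) (h0 : 0 < δ)
    (h1 : δ ≤ 1) :
    T * (S * N) * (T * (2 * Real.exp (-(4 * Real.log (2 * S * N * T / δ))))) ≤ δ := by
  set Q := 2 * S * N * T / δ with hQ
  have hSN : 1 ≤ S * N := one_le_mul_of_one_le_of_one_le hS hN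
  have hQT : T ≤ Q := by
    rw [hQ, le_div_iff₀ h0]
    nlinarith
  have hQ0 : 0 < Q := by linarith
  have hQδ : Q * δ = 2 * S * N * T := div_mul_cancel₀ _ h0.ne'
  have hexp : Real.exp (-(4 * Real.log Q)) = (Q ^ 4)⁻¹ := by
    rw [Real.exp_neg, ← Real.exp_log (by positivity : 0 < Q ^ 4), Real.log_pow]
    norm_num
  rw [hexp]
  have : T * (S * N) * (T * (2 * (Q ^ 4)⁻¹)) = δ * (T * (Q ^ 3)⁻¹) := by
    calc _ = (2 * S * N * T) * T * (Q ^ 4)⁻¹ := by ring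
      _ = Q * δ * T * (Q ^ 4)⁻¹ := by rw [hQδ]
      _ = _ := by field_simp
  rw [this]
  refine mul_le_of_le_one_right h0.le ?_
  rw [← div_eq_mul_inv, div_le_one (by positivity)]
  calc T ≤ Q := hQT
    _ ≤ Q ^ 3 := le_self_pow₀ (by linarith) (by norm_num)

theorem one_le_S (I : UCBInput X) : 1 ≤ I.S := le_max_left _ _

theorem one_le_epLength (k : ℕ) : 1 ≤ epLength k := Nat.one_le_two_pow

theorem one_le_epInput_N (h : Trajectory X) (k : ℕ) : 1 ≤ (epInput O B δ h k).N := by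
  have : (1 : ℝ) ≤ epLength k := by exact_mod_cast one_le_epLength k
  exact Nat.one_le_ceil_iff.2 (by positivity)

variable [MeasurableSpace X]

theorem IsRun.isFeedback (hrun : IsRun μ x ε vStar O B δ G H) (henv : IsEnvironment μ x ε ν)
    (hv : Measurable vStar) :
    IsFeedback μ ν G ε (fun t ω => (H ω).price t - vStar (x t ω)) fun t ω => (H ω).sale t where
  measurable_noise := henv.measurable_noise
  law_noise := henv.law_noise
  noise_indep := hrun.noise_indep
  threshold_meas t := (hrun.price_meas t).sub (hv.comp (hrun.context_meas t))
  meas := hrun.sale_meas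
  eq_ite t ω := by
    rw [hrun.sale_eq]
    simp only [sub_le_iff_le_add']

theorem IsRun.measurable_stampIndicator (hrun : IsRun μ x ε vStar O B δ G H) (k s j τ : ℕ) :
    Measurable[G τ] (stampIndicator H k s j τ) := by
  refine Measurable.ite ?_ measurable_const measurable_const
  refine MeasurableSet.inter (MeasurableSet.const _) (MeasurableSet.inter ?_ ?_)
  · exact hrun.layer_meas τ (measurableSet_singleton s)
  · exact hrun.arm_meas τ (measurableSet_singleton j)

variable [IsProbabilityMeasure μ] [IsProbabilityMeasure ν]

theorem IsRun.withProbAtLeast_noise (hrun : IsRun μ x ε vStar O B δ G H)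
    (henv : IsEnvironment μ x ε ν) (hv : Measurable vStar) (hν : Continuous (cdf ν))
    (h0 : 0 < δ) (h1 : δ ≤ 1) (k : ℕ) :
    WithProbAtLeast μ (1 - δ) fun ω => ∀ t ∈ (epInput O B δ (H ω) k).rounds,
      ∀ s ∈ Finset.Icc 1 (epInput O B δ (H ω) k).S, ∀ j ∈ Finset.Icc 1 (epInput O B δ (H ω) k).N,
        |UCBInput.noiseSum ν vStar (epInput O B δ (H ω) k) (H ω) t s j|
          ≤ Real.sqrt (2 * ((epInput O B δ (H ω) k).stamps (H ω) t s j).card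
            * (epInput O B δ (H ω) k).logTerm) := by
  -- Only the estimator of `epInput` depends on the trajectory. Rounds, layers, grid size and
  -- logarithmic term can be read off at any `ω₀`, so the union bound runs over a deterministic set.
  obtain ⟨ω₀⟩ : Nonempty Ω := nonempty_of_isProbabilityMeasure μ
  set I := epInput O B δ (H ω₀) k with hI
  have hS : (1 : ℝ) ≤ I.S := by exact_mod_cast one_le_S I
  have hN : (1 : ℝ) ≤ I.N := by exact_mod_cast one_le_epInput_N (H ω₀) k
  have hT : (1 : ℝ) ≤ I.T := by exact_mod_cast one_le_epLength k
  have hδ : I.δ = δ := rfl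
  have hl : 0 ≤ I.logTerm := by
    refine Real.log_nonneg ?_
    rw [hδ, le_div_iff₀ h0, one_mul]
    have h2 : (1 : ℝ) * 1 * 1 * 1 ≤ 2 * I.S * I.N * I.T := by gcongr; norm_num
    linarith
  have h := (hrun.isFeedback henv hv).withProbAtLeast_deviation hν
    (I.rounds ×ˢ Finset.Icc 1 I.S ×ˢ Finset.Icc 1 I.N)
    (fun i τ ω => stampIndicator H k i.2.1 i.2.2 τ ω)
    (fun i τ => hrun.measurable_stampIndicator k i.2.1 i.2.2 τ)
    (fun i τ ω => by
      unfold stampIndicator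
      split_ifs <;> simp) (fun i => i.1) I.T I.logTerm hl
  refine h.mono ?_ ?_
  · have h2 := exp_neg_log_bound hS hN hT h0 h1
    have hc : ((I.rounds ×ˢ Finset.Icc 1 I.S ×ˢ Finset.Icc 1 I.N).card : ℝ)
        = I.T * (I.S * I.N) := by
      simp [Finset.card_product, UCBInput.rounds]
    rw [hc]
    exact sub_le_sub_left h2 1
  · intro ω hω t ht s hs j hj
    have hcount := sum_stampIndicator_mul (H := H) (O := O) (B := B) (δ := δ) k s j t ω fun _ => 1
    simp only [mul_one, Finset.sum_const, nsmul_eq_mul] at hcount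
    have hdev : UCBInput.noiseSum ν vStar (epInput O B δ (H ω) k) (H ω) t s j
        = deviation ν (fun t ω => (H ω).price t - vStar (x t ω)) (fun t ω => (H ω).sale t)
          (fun τ ω => stampIndicator H k s j τ ω) t ω := by
      rw [deviation, sum_stampIndicator_mul (O := O) (B := B) (δ := δ), UCBInput.noiseSum]
      simp only [hrun.context_eq]
    rcases Nat.eq_zero_or_pos ((epInput O B δ (H ω) k).stamps (H ω) t s j).card with hz | hz
    · rw [UCBInput.noiseSum, Finset.card_eq_zero.1 hz]
      simp
    · rw [hdev]
      refine hω (t, s, j) (Finset.mem_product.2 ⟨ht, Finset.mem_product.2 ⟨hs, hj⟩⟩) _ hz ?_ hcount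
      refine (Finset.card_filter_le _ _).trans ?_
      rw [Nat.card_Ioo]
      have ht' := (Finset.mem_Ioc.1 ht).2
      change t ≤ epLength k + epLength k at ht'
      change t - epLength k - 1 ≤ epLength k
      omega

end Noise

/-! ### Regret of one call in terms of its length -/

namespace UCBInput

variable {X : Type*} {I : UCBInput X} {h : Trajectory X}
  {ν : Measure ℝ} [IsProbabilityMeasure ν] {vStar pStar : X → ℝ} {L η Bε C : ℝ}

/-- The constant in the regret bound for one call of UCB-LDP. -/
noncomputable def callConst (B L C : ℝ) : ℝ :=
  (9 / 4 * |C| + 4 / |B|) * (3 * |B| + 2) ^ 2 + 120 * |B| + 8 * |B| * |L| + |B|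

theorem callConst_nonneg (B L C : ℝ) : 0 ≤ callConst B L C := by
  unfold callConst
  positivity

/-- With `a = T^{1/5}`, the discretisation term `T N^{-2}` and the exploration term `√(T N)` are
both of order `a³`. The minimum with `T` lets large estimation errors be absorbed by the trivial
bound. -/
theorem Good.sum_regret_le_min [Nonempty X] (hg : Good ν vStar L η I h)
    (hb : BoundedValuation ν vStar Bε I.B) (ho : IsOptimalPrice ν vStar pStar)
    (hC : SecondOrderSmooth ν vStar pStar C) (hT : 1 ≤ I.T)
    (hN : I.N = ⌈(I.T : ℝ) ^ (1 / 5 : ℝ)⌉₊) {Λ : ℝ} (hΛ : 1 ≤ Λ) (hl : 0 ≤ I.logTerm)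
    (hlΛ : I.logTerm ≤ 4 * Λ) (hS : (I.S : ℝ) ≤ 3 * Λ) :
    ∑ t ∈ I.rounds, (rev ν (vStar (h.context t)) (pStar (h.context t))
        - rev ν (vStar (h.context t)) (h.price t))
      ≤ callConst I.B L C * Λ ^ 2 * ((I.T : ℝ) ^ (3 / 5 : ℝ) + min (I.T : ℝ) (η * I.T)) := by
  have hB := hg.B_pos
  have hη := hg.err_nonneg
  have hL := hg.lip_nonneg
  have hT1 : (1 : ℝ) ≤ I.T := by exact_mod_cast hT
  have hT0 : (0 : ℝ) ≤ I.T := by linarith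
  set a : ℝ := (I.T : ℝ) ^ (1 / 5 : ℝ) with ha
  have ha1 : 1 ≤ a := Real.one_le_rpow hT1 (by norm_num)
  have ha5 : (I.T : ℝ) = a ^ 5 := by
    rw [ha, ← Real.rpow_natCast, ← Real.rpow_mul hT0]
    norm_num
  have ha3 : (I.T : ℝ) ^ (3 / 5 : ℝ) = a ^ 3 := by
    rw [ha, ← Real.rpow_natCast, ← Real.rpow_mul hT0]
    norm_num
  have hNa : a ≤ I.N := by
    rw [hN]
    exact Nat.le_ceil _
  have hN2a : (I.N : ℝ) ≤ 2 * a := by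
    rw [hN]
    linarith [Nat.ceil_lt_add_one (by linarith : 0 ≤ a)]
  have hΛ2 : Λ ≤ Λ ^ 2 := le_self_pow₀ hΛ two_ne_zero
  have hmin0 : 0 ≤ min (I.T : ℝ) (η * I.T) := le_min hT0 (by positivity)
  rw [ha3]
  have hK : callConst I.B L C = (9 / 4 * |C| + 4 / I.B) * (3 * I.B + 2) ^ 2 + 120 * I.B
      + 8 * I.B * L + I.B := by
    rw [callConst, abs_of_pos hB, abs_of_nonneg hL]
  -- For `η ≤ 1` the sup norm of the estimator is at most `B + 1`, so the grid spans at most `3 B +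
  -- 2`; for `η > 1` the trivial bound `B T` suffices.
  rcases le_or_gt η 1 with hη1 | hη1
  · have hmin : min (I.T : ℝ) (η * I.T) = η * I.T :=
      min_eq_right (mul_le_of_le_one_left hT0 hη1)
    have hstep : (I.T : ℝ) * I.gridStep ^ 2 ≤ (3 * I.B + 2) ^ 2 * a ^ 3 := by
      have h1 : supNorm I.est ≤ I.B + 1 :=
        supNorm_le fun y => (hg.abs_est_le hb y).trans (by linarith)
      have h2 : I.gridStep ≤ (3 * I.B + 2) / a := by
        unfold gridStep
        have := supNorm_nonneg I.est
        exact div_le_div₀ (by linarith) (by linarith) (by linarith) hNa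
      calc (I.T : ℝ) * I.gridStep ^ 2 ≤ a ^ 5 * ((3 * I.B + 2) / a) ^ 2 := by
            rw [ha5]
            have := hg.gridStep_pos.le
            gcongr
        _ = _ := by field_simp
    have hsqrt : Real.sqrt (I.T * I.N * (2 * I.logTerm + 1)) ≤ 5 * Λ * a ^ 3 := by
      refine Real.sqrt_le_iff.2 ⟨by positivity, ?_⟩
      calc (I.T : ℝ) * I.N * (2 * I.logTerm + 1) ≤ a ^ 5 * (2 * a) * (9 * Λ) := by
            rw [ha5]
            gcongr
            linarith
        _ = 18 * Λ * a ^ 6 := by ring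
        _ ≤ 25 * Λ ^ 2 * a ^ 6 := by
            gcongr
            norm_num
        _ = _ := by ring
    have h3 := hg.sum_regret_le hb ho hC hT hl
    rw [hmin, hK]
    have h4 : (I.S : ℝ) * Real.sqrt (I.T * I.N * (2 * I.logTerm + 1))
        ≤ 3 * Λ * (5 * Λ * a ^ 3) := mul_le_mul hS hsqrt (Real.sqrt_nonneg _) (by positivity)
    have h5 : 8 * I.B * (I.S * Real.sqrt (I.T * I.N * (2 * I.logTerm + 1)))
        ≤ 8 * I.B * (3 * Λ * (5 * Λ * a ^ 3)) := mul_le_mul_of_nonneg_left h4 (by positivity)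
    have h6 : (9 / 4 * |C| + 4 / I.B) * (I.T * I.gridStep ^ 2)
        ≤ (9 / 4 * |C| + 4 / I.B) * ((3 * I.B + 2) ^ 2 * a ^ 3) :=
      mul_le_mul_of_nonneg_left hstep (by positivity)
    have h6' : (9 / 4 * |C| + 4 / I.B) * ((3 * I.B + 2) ^ 2 * a ^ 3) * 1
        ≤ (9 / 4 * |C| + 4 / I.B) * ((3 * I.B + 2) ^ 2 * a ^ 3) * Λ ^ 2 :=
      mul_le_mul_of_nonneg_left (by linarith) (by positivity)
    have h7 : 2 * ((I.S : ℝ) + 1) * (I.B * (L * η)) * I.T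
        ≤ 8 * Λ ^ 2 * (I.B * (L * η)) * I.T := by
      have h8 : 2 * ((I.S : ℝ) + 1) ≤ 8 * Λ ^ 2 := by linarith
      gcongr
    have h8 : 0 ≤ ((9 / 4 * |C| + 4 / I.B) * (3 * I.B + 2) ^ 2 + 120 * I.B + I.B) * Λ ^ 2
        * (η * I.T) := by positivity
    have h9 : 0 ≤ (8 * I.B * L + I.B) * Λ ^ 2 * a ^ 3 := by positivity
    linarith
  · have hmin : min (I.T : ℝ) (η * I.T) = I.T := by
      rw [min_eq_left]
      nlinarith
    have h3 := hg.sum_regret_le_trivial hb ho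
    rw [hmin]
    have h4 : I.B * 1 ≤ callConst I.B L C * Λ ^ 2 := by
      have : I.B ≤ callConst I.B L C := by
        rw [hK]
        have : 0 ≤ (9 / 4 * |C| + 4 / I.B) * (3 * I.B + 2) ^ 2 + 120 * I.B + 8 * I.B * L := by
          positivity
        linarith
      exact mul_le_mul this (by linarith) zero_le_one (callConst_nonneg _ _ _)
    have h5 := mul_le_mul_of_nonneg_right h4 hT0
    have h6 : 0 ≤ callConst I.B L C * Λ ^ 2 * a ^ 3 :=
      mul_nonneg (mul_nonneg (callConst_nonneg _ _ _) (sq_nonneg _)) (by positivity)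
    linarith

end UCBInput

/-! ### Numerical estimates -/

/-- The regret caused by the estimation error in an episode of length `M`, whose estimator was
trained on an episode of length `M / 2`, is at most of the order of the claimed rate. -/
theorem min_le_rate {α ρ M T : ℝ} (hM : 0 < M) (hMT : M ≤ T) (hα : 0 < α) (hρ : 0 ≤ ρ)
    (h : α ≤ 2 ∨ ρ ≤ T ^ (3 * α / 5)) :
    min M (Real.sqrt (ρ / (M / 2) ^ α) * M)
      ≤ 2 ^ (α / 2) * max (T ^ (3 / 5 : ℝ)) (Real.sqrt ρ * T ^ (1 - α / 2)) := by
  have hT : 0 < T := hM.trans_le hMT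
  have h2 : (1 : ℝ) ≤ 2 ^ (α / 2) := Real.one_le_rpow (by norm_num) (by positivity)
  have hη : Real.sqrt (ρ / (M / 2) ^ α) * M = 2 ^ (α / 2) * (Real.sqrt ρ * M ^ (1 - α / 2)) := by
    have hs : Real.sqrt ((M / 2) ^ α) = M ^ (α / 2) / 2 ^ (α / 2) := by
      rw [Real.sqrt_eq_rpow, ← Real.rpow_mul (by positivity), ← Real.div_rpow hM.le zero_le_two]
      congr 1
      ring
    rw [Real.sqrt_div hρ, hs, Real.rpow_sub hM, Real.rpow_one]
    have h3 : (0 : ℝ) < M ^ (α / 2) := by positivity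
    field_simp
  have h20 : (0 : ℝ) ≤ 2 ^ (α / 2) := by linarith
  by_cases hα2 : α ≤ 2
  · refine (min_le_right _ _).trans ?_
    rw [hη]
    refine mul_le_mul_of_nonneg_left (le_trans ?_ (le_max_right _ _)) h20
    exact mul_le_mul_of_nonneg_left (Real.rpow_le_rpow hM.le hMT (by linarith))
      (Real.sqrt_nonneg _)
  · have hρT := h.resolve_left hα2
    -- For `α > 2` the bound `√ρ M^{1-α/2}` decreases in `M`, so short episodes are the critical
    -- ones. Those with `M ≤ b` have trivial cost at most `b`, and for longer ones `√ρ ≤ b^{α/2}`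
    -- again gives `b`.
    set b : ℝ := T ^ (3 / 5 : ℝ) with hb
    have hb0 : 0 < b := by positivity
    have hsq : Real.sqrt ρ ≤ b ^ (α / 2) := by
      refine (Real.sqrt_le_sqrt hρT).trans (le_of_eq ?_)
      rw [Real.sqrt_eq_rpow, hb, ← Real.rpow_mul hT.le, ← Real.rpow_mul hT.le]
      congr 1
      ring
    have hgoal : min M (Real.sqrt (ρ / (M / 2) ^ α) * M) ≤ 2 ^ (α / 2) * b := by
      rcases le_or_gt M b with hMb | hMb
      · refine (min_le_left _ _).trans (hMb.trans ?_)
        exact le_mul_of_one_le_left hb0.le h2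
      · refine (min_le_right _ _).trans ?_
        rw [hη]
        refine mul_le_mul_of_nonneg_left ?_ h20
        calc Real.sqrt ρ * M ^ (1 - α / 2) ≤ b ^ (α / 2) * b ^ (1 - α / 2) := by
              refine mul_le_mul hsq ?_ (by positivity) (by positivity)
              exact Real.rpow_le_rpow_of_nonpos hb0 hMb.le (by linarith)
          _ = b := by
              rw [← Real.rpow_add hb0]
              simp
    exact hgoal.trans (mul_le_mul_of_nonneg_left (le_max_left _ _) h20)

theorem sum_Icc_two_pow (f : ℕ → ℝ) (m : ℕ) :
    ∑ t ∈ Finset.Icc 1 (2 ^ m), f t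
      = f 1 + ∑ k ∈ Finset.Icc 1 m, ∑ t ∈ Finset.Ioc (2 ^ (k - 1)) (2 ^ k), f t := by
  induction m with
  | zero => simp
  | succ m ih =>
    rw [Finset.sum_Icc_succ_top (by omega), ← add_assoc, ← ih, Nat.add_sub_cancel]
    have h1 : Finset.Icc 1 (2 ^ m) = Finset.Ioc 0 (2 ^ m) := by ext; simp [Nat.succ_le_iff]
    have h2 : Finset.Icc 1 (2 ^ (m + 1)) = Finset.Ioc 0 (2 ^ (m + 1)) := by
      ext; simp [Nat.succ_le_iff]
    rw [h1, h2, Finset.sum_Ioc_consecutive _ (Nat.zero_le _)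
      (Nat.pow_le_pow_right two_pos m.le_succ)]

/-! ### Parameters of an episode -/

section Episode

variable {X : Type*} {O : Oracle X} {B δ : ℝ} {h : Trajectory X}

theorem rounds_epInput {k : ℕ} (hk : 1 ≤ k) :
    (epInput O B δ h k).rounds = Finset.Ioc (2 ^ (k - 1)) (2 ^ k) := by
  obtain ⟨k, rfl⟩ := Nat.exists_eq_add_of_le' hk
  change Finset.Ioc (2 ^ k) (2 ^ k + 2 ^ k) = _
  rw [Nat.add_sub_cancel, pow_succ, mul_two]

theorem S_epInput_le {k : ℕ} (hk : 1 ≤ k) : (epInput O B δ h k).S ≤ k := by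
  refine max_le hk (Nat.ceil_le.2 ?_)
  have h1 : ((epInput O B δ h k).T : ℝ) = 2 ^ (k - 1) := by simp [epInput, epLength]
  rw [h1, Real.logb_pow, Real.logb_self_eq_one (by norm_num)]
  have : ((k - 1 : ℕ) : ℝ) ≤ k := by exact_mod_cast Nat.sub_le _ _
  have h0 : (0 : ℝ) ≤ ((k - 1 : ℕ) : ℝ) := Nat.cast_nonneg _
  linarith

theorem N_epInput_le (k : ℕ) : (epInput O B δ h k).N ≤ epLength k := by
  refine Nat.ceil_le.2 ?_
  have : (1 : ℝ) ≤ epLength k := by exact_mod_cast one_le_epLength k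
  exact (Real.rpow_le_rpow_of_exponent_le this (by norm_num : (1 / 5 : ℝ) ≤ 1)).trans_eq
    (Real.rpow_one _)

theorem logTerm_epInput {k : ℕ} (hk : 1 ≤ k) {T : ℝ} (hT : 2 ≤ T) (hkT : (epLength k : ℝ) ≤ T)
    (h0 : 0 < δ) (h1 : δ ≤ 1) : 0 ≤ (epInput O B δ h k).logTerm ∧
      (epInput O B δ h k).logTerm ≤ 4 * Real.log (T / δ) := by
  set I := epInput O B δ h k with hI
  have hS : (1 : ℝ) ≤ I.S := by exact_mod_cast one_le_S I
  have hN : (1 : ℝ) ≤ I.N := by exact_mod_cast one_le_epInput_N h k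
  have hTk : (1 : ℝ) ≤ I.T := by exact_mod_cast one_le_epLength k
  have hTT : (I.T : ℝ) ≤ T := hkT
  have hδ : I.δ = δ := rfl
  have hST : (I.S : ℝ) ≤ T := by
    have h2 : k ≤ epLength k := by
      have := (k - 1).lt_two_pow_self
      unfold epLength
      omega
    have h3 : (I.S : ℝ) ≤ epLength k := by exact_mod_cast (S_epInput_le hk).trans h2
    exact h3.trans hkT
  have hNT : (I.N : ℝ) ≤ T := le_trans (by exact_mod_cast N_epInput_le k) hkT
  have hone : 1 ≤ 2 * (I.S : ℝ) * I.N * I.T / δ := by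
    rw [le_div_iff₀ h0, one_mul]
    have h2 : (1 : ℝ) * 1 * 1 * 1 ≤ 2 * I.S * I.N * I.T := by gcongr; norm_num
    linarith
  refine ⟨Real.log_nonneg hone, ?_⟩
  have h4 : 2 * (I.S : ℝ) * I.N * I.T / δ ≤ (T / δ) ^ 4 := by
    have h5 : 2 * (I.S : ℝ) * I.N * I.T ≤ T * T * T * T := by gcongr
    rw [div_pow]
    have h6 : δ ^ 4 ≤ δ := pow_le_of_le_one h0.le h1 (by norm_num)
    calc 2 * (I.S : ℝ) * I.N * I.T / δ ≤ T * T * T * T / δ := by gcongr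
      _ = T ^ 4 / δ := by ring
      _ ≤ T ^ 4 / δ ^ 4 := by gcongr
  calc I.logTerm ≤ Real.log ((T / δ) ^ 4) := Real.log_le_log (zero_lt_one.trans_le hone) h4
    _ = _ := by rw [Real.log_pow]; norm_num

end Episode

theorem ceil_logb_le {T : ℕ} (hT : 2 ≤ T) {δ : ℝ} (h0 : 0 < δ) (h1 : δ ≤ 1 / 2) :
    1 ≤ Real.log (T / δ) ∧ (⌈Real.logb 2 (T : ℝ)⌉₊ : ℝ) ≤ 3 * Real.log (T / δ) := by
  have hT2 : (2 : ℝ) ≤ T := by exact_mod_cast hT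
  have hTpos : (0 : ℝ) < T := by linarith
  have hlog2 := Real.log_two_gt_d9
  have h3 : Real.log 2 ≤ Real.log T := Real.log_le_log two_pos hT2
  have h4 : Real.log (T / δ) = Real.log T - Real.log δ := Real.log_div hTpos.ne' h0.ne'
  have h5 : Real.log δ ≤ -Real.log 2 := by
    rw [← Real.log_inv]
    exact Real.log_le_log h0 (by linarith)
  have hlb : Real.logb 2 T ≤ 3 / 2 * Real.log T := by
    rw [Real.logb, div_le_iff₀ (by linarith)]
    nlinarith
  have h6 := Nat.ceil_lt_add_one (Real.logb_nonneg one_lt_two (by linarith : (1 : ℝ) ≤ T))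
  constructor <;> linarith

section Run

variable {Ω X : Type*} [MeasurableSpace X] {mΩ : MeasurableSpace Ω} {μ : Measure Ω}
  {x : ℕ → Ω → X} {ε : ℕ → Ω → ℝ} {ν : Measure ℝ} {vStar pStar : X → ℝ} {O : Oracle X}
  {B δ L C η α Bε : ℝ} {G : Filtration ℕ mΩ} {H : Ω → Trajectory X}

theorem IsRun.good (hrun : IsRun μ x ε vStar O B δ G H) (hb : BoundedValuation ν vStar Bε B)
    (hL : 0 ≤ L) (hlip : ∀ a b : ℝ, |cdf ν a - cdf ν b| ≤ L * |a - b|) (hη : 0 ≤ η) {ω : Ω}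
    {k : ℕ} (hk : 1 ≤ k) (hacc : ∀ z, |estimator O δ (H ω) k z - vStar z| ≤ η)
    (hnoise : ∀ t ∈ (epInput O B δ (H ω) k).rounds,
      ∀ s ∈ Finset.Icc 1 (epInput O B δ (H ω) k).S, ∀ j ∈ Finset.Icc 1 (epInput O B δ (H ω) k).N,
        |UCBInput.noiseSum ν vStar (epInput O B δ (H ω) k) (H ω) t s j|
          ≤ Real.sqrt (2 * ((epInput O B δ (H ω) k).stamps (H ω) t s j).card
            * (epInput O B δ (H ω) k).logTerm)) :
    UCBInput.Good ν vStar L η (epInput O B δ (H ω) k) (H ω) where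
  B_pos := hb.pos (x 0 ω)
  N_pos := one_le_epInput_N (H ω) k
  lip_nonneg := hL
  err_nonneg := hη
  lipschitz := hlip
  accurate := hacc
  round t ht := (hrun.follows ω).2 k hk t (by rwa [rounds_epInput hk] at ht)
  sale_mem t := by
    rw [hrun.sale_eq]
    split_ifs <;> simp
  noise := hnoise

end Run

/-! ### Regret of an episode and of the whole run -/

section Regret

variable {X : Type*} {ν : Measure ℝ} [IsProbabilityMeasure ν] {vStar pStar : X → ℝ}
  {O : Oracle X} {B δ L C α Bε r : ℝ} {h : Trajectory X}

/-- The regret of one episode in which the estimator and all confidence intervals are accurate. -/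
theorem sum_regret_episode_le [Nonempty X] (hb : BoundedValuation ν vStar Bε B)
    (ho : IsOptimalPrice ν vStar pStar) (hC : SecondOrderSmooth ν vStar pStar C) {T k : ℕ}
    (hT : 2 ≤ T) (h0 : 0 < δ) (h1 : δ ≤ 1 / 2) (hα : 0 < α) (hr : 0 ≤ r)
    (hrT : α ≤ 2 ∨ r ≤ (T : ℝ) ^ (3 * α / 5)) (hk : 1 ≤ k) (hkT : epLength k ≤ T)
    (hkM : k ≤ ⌈Real.logb 2 (T : ℝ)⌉₊)
    (hg : UCBInput.Good ν vStar L
      (if k ≤ 1 then B else Real.sqrt (r / ((epLength (k - 1) : ℕ) : ℝ) ^ α))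
      (epInput O B δ h k) h) :
    ∑ t ∈ Finset.Ioc (2 ^ (k - 1)) (2 ^ k), (rev ν (vStar (h.context t)) (pStar (h.context t))
        - rev ν (vStar (h.context t)) (h.price t))
      ≤ (2 * 2 ^ (α / 2) * UCBInput.callConst B L C + |B|) * Real.log ((T : ℝ) / δ) ^ 2
        * max ((T : ℝ) ^ (3 / 5 : ℝ)) (Real.sqrt r * (T : ℝ) ^ (1 - α / 2)) := by
  obtain ⟨hΛ1, hMΛ⟩ := ceil_logb_le hT h0 h1
  set Λ := Real.log ((T : ℝ) / δ)
  set R := max ((T : ℝ) ^ (3 / 5 : ℝ)) (Real.sqrt r * (T : ℝ) ^ (1 - α / 2)) with hR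
  have hT1 : (1 : ℝ) ≤ T := by exact_mod_cast (by omega : 1 ≤ T)
  have hR1 : 1 ≤ R := (Real.one_le_rpow hT1 (by norm_num)).trans (le_max_left _ _)
  have hΛ2 : 1 ≤ Λ ^ 2 := one_le_pow₀ hΛ1
  have hK0 := UCBInput.callConst_nonneg B L C
  have h2 : (1 : ℝ) ≤ 2 ^ (α / 2) := Real.one_le_rpow (by norm_num) (by positivity)
  have hBpos : 0 < B := hg.B_pos
  rw [← rounds_epInput (O := O) (B := B) (δ := δ) (h := h) hk]
  -- The first episode has a single round and no trained estimator, so its regret is bounded by `B`.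
  rcases hk.eq_or_lt with rfl | hk2
  · refine (hg.sum_regret_le_trivial hb ho).trans ?_
    have h3 : (epInput O B δ h 1).B * ((epInput O B δ h 1).T : ℝ) = B := by
      simp [epInput, epLength]
    rw [h3]
    have h4 : B ≤ 2 * 2 ^ (α / 2) * UCBInput.callConst B L C + |B| := by
      have : 0 ≤ 2 * 2 ^ (α / 2) * UCBInput.callConst B L C := by positivity
      linarith [le_abs_self B]
    have h5 : 1 ≤ Λ ^ 2 * R := one_le_mul_of_one_le_of_one_le hΛ2 hR1
    rw [mul_assoc]
    exact h4.trans (le_mul_of_one_le_right (hBpos.le.trans h4) h5)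
  · rw [if_neg (by omega)] at hg
    obtain ⟨hl0, hl1⟩ := logTerm_epInput (O := O) (B := B) (h := h) hk
      (by exact_mod_cast hT : (2 : ℝ) ≤ T) (by exact_mod_cast hkT) h0 (by linarith)
    have hS : ((epInput O B δ h k).S : ℝ) ≤ 3 * Λ :=
      le_trans (by exact_mod_cast (S_epInput_le hk).trans hkM) hMΛ
    refine (hg.sum_regret_le_min hb ho hC (one_le_epLength k) rfl hΛ1 hl0 hl1 hS).trans ?_
    have hM : (0 : ℝ) < epLength k := by exact_mod_cast one_le_epLength k
    have hMT : (epLength k : ℝ) ≤ T := by exact_mod_cast hkT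
    have hhalf : ((epLength (k - 1) : ℕ) : ℝ) = (epLength k : ℝ) / 2 := by
      obtain ⟨k, rfl⟩ := Nat.exists_eq_add_of_le' hk2
      simp [epLength, pow_succ]
    have hmin := min_le_rate hM hMT hα hr hrT
    rw [← hhalf] at hmin
    change UCBInput.callConst B L C * Λ ^ 2 * ((epLength k : ℝ) ^ (3 / 5 : ℝ)
      + min (epLength k : ℝ) (Real.sqrt (r / ((epLength (k - 1) : ℕ) : ℝ) ^ α) * epLength k)) ≤ _
    have h3 : (epLength k : ℝ) ^ (3 / 5 : ℝ) ≤ 2 ^ (α / 2) * R :=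
      ((Real.rpow_le_rpow hM.le hMT (by norm_num)).trans (le_max_left _ _)).trans
        (le_mul_of_one_le_left (by linarith) h2)
    have h4 := mul_le_mul_of_nonneg_left (add_le_add h3 hmin)
      (by positivity : 0 ≤ UCBInput.callConst B L C * Λ ^ 2)
    have h5 : 0 ≤ |B| * Λ ^ 2 * R := by positivity
    linarith

theorem epLength_le_of_le_ceil {T k : ℕ} (hT : 2 ≤ T) (hk : 1 ≤ k)
    (hkM : k ≤ ⌈Real.logb 2 (T : ℝ)⌉₊) : epLength k ≤ T := by
  have h1 : k - 1 < ⌈Real.logb 2 (T : ℝ)⌉₊ := by omega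
  have h2 := Nat.lt_ceil.1 h1
  rw [Real.lt_logb_iff_rpow_lt one_lt_two (by positivity), Real.rpow_natCast] at h2
  exact_mod_cast h2.le

theorem le_two_pow_ceil {T : ℕ} (hT : 2 ≤ T) : T ≤ 2 ^ ⌈Real.logb 2 (T : ℝ)⌉₊ := by
  have h2 := Nat.le_ceil (Real.logb 2 (T : ℝ))
  rw [Real.logb_le_iff_le_rpow one_lt_two (by positivity), Real.rpow_natCast] at h2
  exact_mod_cast h2

/-- The regret bound on the event that all estimators and confidence intervals are accurate. -/
theorem regret_le_of_good [Nonempty X] (hb : BoundedValuation ν vStar Bε B)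
    (ho : IsOptimalPrice ν vStar pStar) (hC : SecondOrderSmooth ν vStar pStar C) {T : ℕ}
    (hT : 2 ≤ T) (h0 : 0 < δ) (h1 : δ ≤ 1 / 2) (hα : 0 < α) (hr : 0 ≤ r)
    (hrT : α ≤ 2 ∨ r ≤ (T : ℝ) ^ (3 * α / 5)) (hp1 : h.price 1 ∈ Set.Icc 0 B)
    (hg : ∀ k ∈ Finset.Icc 1 ⌈Real.logb 2 (T : ℝ)⌉₊, UCBInput.Good ν vStar L
      (if k ≤ 1 then B else Real.sqrt (r / ((epLength (k - 1) : ℕ) : ℝ) ^ α))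
      (epInput O B δ h k) h) :
    regret ν vStar pStar h T
      ≤ (3 * (2 * 2 ^ (α / 2) * UCBInput.callConst B L C + |B|) + |B| + 1)
        * Real.log ((T : ℝ) / δ) ^ 3
        * max ((T : ℝ) ^ (3 / 5 : ℝ)) (Real.sqrt r * (T : ℝ) ^ (1 - α / 2)) := by
  obtain ⟨hΛ1, hMΛ⟩ := ceil_logb_le hT h0 h1
  have hep := fun k hk => sum_regret_episode_le hb ho hC hT h0 h1 hα hr hrT
    (Finset.mem_Icc.1 hk).1 (epLength_le_of_le_ceil hT (Finset.mem_Icc.1 hk).1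
    (Finset.mem_Icc.1 hk).2) (Finset.mem_Icc.1 hk).2 (hg k hk)
  set Λ := Real.log ((T : ℝ) / δ)
  set R := max ((T : ℝ) ^ (3 / 5 : ℝ)) (Real.sqrt r * (T : ℝ) ^ (1 - α / 2)) with hR
  set M := ⌈Real.logb 2 (T : ℝ)⌉₊
  set K := 2 * 2 ^ (α / 2) * UCBInput.callConst B L C + |B| with hK
  have hK0 : 0 ≤ K := by
    have := UCBInput.callConst_nonneg B L C
    positivity
  have hT1 : (1 : ℝ) ≤ T := by exact_mod_cast (by omega : 1 ≤ T)
  have hR1 : 1 ≤ R := (Real.one_le_rpow hT1 (by norm_num)).trans (le_max_left _ _)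
  set f : ℕ → ℝ := fun t => rev ν (vStar (h.context t)) (pStar (h.context t))
    - rev ν (vStar (h.context t)) (h.price t) with hf
  have hprice : ∀ t ∈ Finset.Icc 1 (2 ^ M), 0 ≤ h.price t := by
    intro t ht
    obtain ⟨ht1, ht2⟩ := Finset.mem_Icc.1 ht
    rcases ht1.eq_or_lt with rfl | ht1
    · exact hp1.1
    · have hk1 : 1 ≤ Nat.clog 2 t := Nat.clog_pos one_lt_two ht1
      have hkM : Nat.clog 2 t ≤ M := Nat.clog_le_of_le_pow ht2
      refine ((hg _ (Finset.mem_Icc.2 ⟨hk1, hkM⟩)).price_mem (t := t) ?_).1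
      rw [rounds_epInput hk1, Finset.mem_Ioc]
      exact ⟨Nat.pow_pred_clog_lt_self one_lt_two ht1, Nat.le_pow_clog one_lt_two t⟩
  -- The last episode may extend beyond `T`. Completing it only adds nonnegative terms, because all
  -- posted prices are nonnegative.
  have hle : regret ν vStar pStar h T ≤ ∑ t ∈ Finset.Icc 1 (2 ^ M), f t := by
    refine Finset.sum_le_sum_of_subset_of_nonneg
      (Finset.Icc_subset_Icc le_rfl (le_two_pow_ceil hT)) fun t ht _ => ?_
    exact sub_nonneg.2 ((ho _).2 _ (hprice t ht))
  rw [sum_Icc_two_pow] at hle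
  have hf1 : f 1 ≤ |B| := by
    have h3 := rev_nonneg (ν := ν) (q := vStar (h.context 1)) hp1.1
    have h4 := hb.rev_optimal_le ho (h.context 1)
    simp only [hf]
    linarith [le_abs_self B]
  have hsum := Finset.sum_le_card_nsmul _ _ _ hep
  rw [Nat.card_Icc, nsmul_eq_mul, Nat.add_sub_cancel] at hsum
  have h5 : (M : ℝ) * (K * Λ ^ 2 * R) ≤ 3 * Λ * (K * Λ ^ 2 * R) :=
    mul_le_mul_of_nonneg_right hMΛ (by positivity)
  have h6 : 1 ≤ Λ ^ 3 * R := one_le_mul_of_one_le_of_one_le (one_le_pow₀ hΛ1) hR1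
  have h7 : |B| * 1 ≤ |B| * (Λ ^ 3 * R) := mul_le_mul_of_nonneg_left h6 (abs_nonneg B)
  have h8 : 0 ≤ Λ ^ 3 * R := by linarith
  linarith

end Regret

end DynPricing

theorem mainTheorem5 :
    ∃ c : ℕ, ∀ B L C α : ℝ, 0 < α → ∃ K : ℝ, 0 < K ∧
      ∀ (d : ℕ) (𝒳 : Set (EuclideanSpace ℝ (Fin d))) (𝒱 : Set (𝒳 → ℝ))
        (ν : MeasureTheory.Measure ℝ) [MeasureTheory.IsProbabilityMeasure ν]
        (vStar pStar : 𝒳 → ℝ) (Bε : ℝ)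
        (O : DynPricing.Oracle 𝒳) (ρ : ℝ → ℝ) (T : ℕ) (δ : ℝ)
        (Ω : Type*) [mΩ : MeasurableSpace Ω] (μ : MeasureTheory.Measure Ω)
        [MeasureTheory.IsProbabilityMeasure μ]
        (x : ℕ → Ω → 𝒳) (ε : ℕ → Ω → ℝ)
        (G : MeasureTheory.Filtration ℕ mΩ) (H : Ω → DynPricing.Trajectory 𝒳),
        -- the pricing model
        DynPricing.IsEnvironment μ x ε ν →
        Measurable vStar →
        DynPricing.IsOptimalPrice ν vStar pStar →
        -- realizability, and the oracle returns elements of the class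
        vStar ∈ 𝒱 →
        (∀ δ' n D, O δ' n D ∈ 𝒱) →
        -- bounded valuation
        DynPricing.BoundedValuation ν vStar Bε B →
        -- Lipschitz continuity of the noise distribution
        (∀ a b : ℝ, |ProbabilityTheory.cdf ν a - ProbabilityTheory.cdf ν b| ≤ L * |a - b|) →
        -- second-order smoothness
        DynPricing.SecondOrderSmooth ν vStar pStar C →
        -- the horizon and the confidence parameter
        2 ≤ T →
        0 < δ →
        δ < 1 / (2 * (⌈Real.logb 2 (T : ℝ)⌉₊ : ℝ)) →
        0 ≤ ρ δ →
        (α ≤ 2 ∨ ρ δ ≤ (T : ℝ) ^ (3 * α / 5)) →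
        -- a run of the algorithm
        DynPricing.IsRun μ x ε vStar O B δ G H →
        -- the online classification oracle is accurate on the data collected in each episode
        (∀ k, 1 ≤ k → DynPricing.OracleAccurate μ vStar O ρ α δ (DynPricing.epLength k)
          (fun ω => DynPricing.epData (H ω) k)) →
        DynPricing.WithProbAtLeast μ (1 - 2 * (⌈Real.logb 2 (T : ℝ)⌉₊ : ℝ) * δ) (fun ω =>
          DynPricing.regret ν vStar pStar (H ω) T ≤
            K * Real.log ((T : ℝ) / δ) ^ c *
              max ((T : ℝ) ^ (3 / 5 : ℝ)) (Real.sqrt (ρ δ) * (T : ℝ) ^ (1 - α / 2))) := by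
  refine ⟨3, fun B L C α hα => ⟨3 * (2 * 2 ^ (α / 2) * DynPricing.UCBInput.callConst B L C + |B|)
    + |B| + 1, ?_, ?_⟩⟩
  · have := DynPricing.UCBInput.callConst_nonneg B L C
    positivity
  intro d 𝒳 𝒱 ν _ vStar pStar Bε O ρ T δ Ω mΩ μ _ x ε G H henv hvm ho _ _ hb hlip hC hT hδ0 hδ1
    hρ hρT hrun horacle
  set M := ⌈Real.logb 2 (T : ℝ)⌉₊ with hM
  obtain ⟨ω₀⟩ : Nonempty Ω := nonempty_of_isProbabilityMeasure μ
  have : Nonempty 𝒳 := ⟨x 0 ω₀⟩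
  have hL : 0 ≤ L := by
    have := (abs_nonneg _).trans (hlip 1 0)
    simpa using this
  have hcont : Continuous (cdf ν) :=
    (LipschitzWith.of_dist_le_mul (K := ⟨L, hL⟩) fun a b => hlip a b).continuous
  have hM1 : (1 : ℝ) ≤ M := by
    have : 0 < M := Nat.ceil_pos.2 (Real.logb_pos one_lt_two (by exact_mod_cast hT))
    exact_mod_cast this
  have hδ : δ ≤ 1 / 2 := hδ1.le.trans (by gcongr; linarith)
  have hB : 0 < B := hb.pos (x 0 ω₀)
  -- `M` oracle events and `M` noise events, each failing with probability at most `δ`, account for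
  -- `2 M δ`.
  have h1 := DynPricing.WithProbAtLeast.forall_finset (μ := μ) (Finset.Icc 1 M)
    (a := fun _ => δ) fun k hk => horacle k (Finset.mem_Icc.1 hk).1
  have h2 := DynPricing.WithProbAtLeast.forall_finset (μ := μ) (Finset.Icc 1 M)
    (a := fun _ => δ) fun k _ =>
      hrun.withProbAtLeast_noise henv hvm hcont hδ0 (by linarith) k
  refine (h1.and h2).mono (le_of_eq ?_) ?_
  · simp only [Finset.sum_const, Nat.card_Icc, nsmul_eq_mul, Nat.add_sub_cancel]
    ring
  · rintro ω ⟨hacc, hnoise⟩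
    refine DynPricing.regret_le_of_good (O := O) hb ho hC hT hδ0 hδ hα hρ hρT (hrun.follows ω).1 ?_
    intro k hk
    have hk1 := (Finset.mem_Icc.1 hk).1
    refine hrun.good hb hL hlip (by split_ifs <;> positivity) hk1 ?_ (hnoise k hk)
    intro z
    unfold DynPricing.estimator
    split_ifs with hk2
    -- The zero estimator of the first episode has error at most `B`, since `v*` takes values in
    -- `[0, B]`.
    · have h3 := hb.valuation_mem z
      have h4 := hb.noise_pos
      rw [Pi.zero_apply, zero_sub, abs_neg, abs_le]
      constructor <;> linarith [h3.1, h3.2]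
    · refine hacc (k - 1) (Finset.mem_Icc.2 ⟨by omega, ?_⟩) z
      have := (Finset.mem_Icc.1 hk).2
      omega
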